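/- Let $m\ge 1$ and let $H^m=\mathbb R^{2m+1}$, with points $q=(x,y,t)$, $x,y\in\mathbb R^m$, $t\in\mathbb R$, be the Heisenberg group, with left-invariant horizontal vector fields $$X_j=\frac{\partial}{\partial x_j}+2y_j\frac{\partial}{\partial t},\qquad Y_j=\frac{\partial}{\partial y_j}-2x_j\frac{\partial}{\partial t},\qquad j=1,\dots,m.$$ For $u\in C^1(H^m)$ let $\nabla_{H^m}u=\sum_j (X_ju)X_j+(Y_ju)Y_j$, and let $\cdot$ and $|\cdot|_{H^m}$ be the inner product and the norm on the span of the $X_j,Y_j$ that make them orthonormal. Let $\varphi,f,l:[0,+\infty)\to\mathbb R$ satisfy: ($\Phi$) $\varphi\in C^0([0,+\infty))\cap C^1((0,+\infty))$, $\varphi(0)=0$, and $\varphi'>0$ on $(0,+\infty)$. ($F$) $f\in C^0([0,+\infty))$, $f>0$ on $(0,+\infty)$, and $f$ is increasing on $[0,+\infty)$ (not necessarily strictly). ($L$) $l\in C^0([0,+\infty))$, $l>0$ on $(0,+\infty)$, and there is $C\ge1$ with $\sup_{s\in[0,t]}l(s)\le C\,l(t)$ for all $t\ge0$. ($\Phi\,\&\,L$)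 The function $t\varphi'(t)/l(t)$ is integrable near $0^+$ and is not integrable near $+\infty$, and $\varphi(t)/l(t)\to0$ as $t\to0^+$. ($\Phi2$), ($L2$) There are constants $D,\Lambda>0$ and $\tau\ge0$ such that $$s\,\varphi'(st)\le D\,s^{\tau}\varphi'(t)\quad\text{for all } s\in(0,1],\ t>0,\qquad s^{1+\tau}l(t)\le\Lambda\,l(st)\quad\text{for all } s\in[0,1],\ t\ge0.$$ Put $K(t)=\int_0^t \frac{s\varphi'(s)}{l(s)}\,ds$, which is an increasing bijection of $[0,+\infty)$ onto itself with inverse $K^{-1}$, and $F(t)=\int_0^t f(s)\,ds$. Assume the generalized Keller–Osserman condition $$\frac{1}{K^{-1}(F(t))}\in L^1(+\infty),$$ that is, this function is integrable on $[a,+\infty)$ for some $a>0$. Let $u\in C^1(H^m)$, $u\ge0$, be a weak solution of $$\Delta^\varphi_{H^m}u\ \ge\ f(u)\,l\big(|\nabla_{H^m}u|_{H^m}\big)\qquad\text{on } H^m,$$ that is, for every $\zeta\in C_0^\infty(H^m)$ with $\zeta\ge0$, $$-\int_{\mathbb R^{2m+1}}|\nabla_{H^m}u|_{H^m}^{-1}\,\varphi\big(|\nabla_{H^m}u|_{H^m}\big)\,\nabla_{H^m}u\cdot\nabla_{H^m}\zeta\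 \ge\ \int_{\mathbb R^{2m+1}}f(u)\,l\big(|\nabla_{H^m}u|_{H^m}\big)\,\zeta,$$ where the first integrand is taken to be $0$ wherever $\nabla_{H^m}u=0$. Then $u$ is constant. If, in addition, $l(0)>0$, then $u\equiv0$. -/

import Mathlib

open MeasureTheory Set Filter Topology
open scoped ContDiff

namespace HeisenbergLiouville

noncomputable section

/-- The manifold `ℝ^{2m+1}` underlying the Heisenberg group `H^m`, with points
`q = (x, y, t)`. The group law is
`(x, y, t) ∘ (x', y', t') = (x + x', y + y', t + t' + 2 ∑ i, (y i * x' i - x i * y' i))`;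
it enters below through its left-invariant vector fields `X_j`, `Y_j`. The measure on this
product is Lebesgue measure. -/
abbrev Heis (m : ℕ) : Type := (Fin m → ℝ) × (Fin m → ℝ) × ℝ

variable {m : ℕ}

/-- The left-invariant vector field `X_j = ∂/∂x_j + 2 y_j ∂/∂t`. -/
def vecX (j : Fin m) (q : Heis m) : Heis m := (Pi.single j 1, 0, 2 * q.2.1 j)

/-- The left-invariant vector field `Y_j = ∂/∂y_j - 2 x_j ∂/∂t`. -/
def vecY (j : Fin m) (q : Heis m) : Heis m := (0, Pi.single j 1, -2 * q.1 j)

/-- The Heisenberg gradient, by its components `X_j u`, `Y_j u` in the frame `X_j`, `Y_j`.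
The Euclidean inner product and norm of the target are the product `W · Z` and the norm
`|W|_{H^m}` for which this frame is orthonormal. -/
def hgrad (u : Heis m → ℝ) (q : Heis m) : EuclideanSpace ℝ (Fin m ⊕ Fin m) :=
  WithLp.toLp 2 (Sum.elim (fun j => fderiv ℝ u q (vecX j q)) (fun j => fderiv ℝ u q (vecY j q)))

/-- `u` is an entire weak classical solution of `Δ^φ u ≥ f(u) l(|∇u|)` on `H^m`: `u` is of
class `C^1` and, for every `0 ≤ ζ ∈ C_0^∞(H^m)`,
`- ∫ |∇u|⁻¹ φ(|∇u|) ∇u · ∇ζ ≥ ∫ f(u) l(|∇u|) ζ`, all gradients being Heisenberg gradients.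
Where `∇u = 0` the vector `|∇u|⁻¹ φ(|∇u|) ∇u` is `0`. -/
def IsWeakSolution (φ f l : ℝ → ℝ) (u : Heis m → ℝ) : Prop :=
  ContDiff ℝ 1 u ∧
  ∀ ζ : Heis m → ℝ, ContDiff ℝ ∞ ζ → HasCompactSupport ζ → (∀ q, 0 ≤ ζ q) →
    ∫ q, f (u q) * l ‖hgrad u q‖ * ζ q ≤
      -∫ q, ‖hgrad u q‖⁻¹ * φ ‖hgrad u q‖ * inner ℝ (hgrad u q) (hgrad ζ q)

/-- Condition `(Φ)`. -/
structure CondPhi (φ : ℝ → ℝ) : Prop where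
  continuousOn : ContinuousOn φ (Ici 0)
  contDiffOn : ContDiffOn ℝ 1 φ (Ioi 0)
  map_zero : φ 0 = 0
  deriv_pos : ∀ t, 0 < t → 0 < deriv φ t

/-- Condition `(F)`. -/
structure CondF (f : ℝ → ℝ) : Prop where
  continuousOn : ContinuousOn f (Ici 0)
  pos : ∀ t, 0 < t → 0 < f t
  monotoneOn : MonotoneOn f (Ici 0)

/-- `l` is `C`-monotone non-decreasing on `[0, ∞)` for some `C ≥ 1`:
`sup_{s ∈ [0,t]} l(s) ≤ C l(t)` for all `t ≥ 0`. -/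
def CMonotone (l : ℝ → ℝ) : Prop :=
  ∃ C : ℝ, 1 ≤ C ∧ ∀ t, 0 ≤ t → ∀ s ∈ Icc 0 t, l s ≤ C * l t

/-- Condition `(L)`. -/
structure CondL (l : ℝ → ℝ) : Prop where
  continuousOn : ContinuousOn l (Ici 0)
  pos : ∀ t, 0 < t → 0 < l t
  cMonotone : CMonotone l

/-- Condition `(Φ & L)`: `t φ'(t) / l(t) ∈ L^1(0^+) \ L^1(+∞)` and `φ(t) / l(t) = o(1)` as
`t → 0^+`. -/
structure CondPhiL (φ l : ℝ → ℝ) : Prop where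
  integrable_zero : IntegrableAtFilter (fun t => t * deriv φ t / l t) (𝓝[>] 0) volume
  not_integrable_top : ¬ IntegrableAtFilter (fun t => t * deriv φ t / l t) atTop volume
  tendsto_zero : Tendsto (fun t => φ t / l t) (𝓝[>] 0) (𝓝 0)

/-- Condition `(Φ2)` with constants `D`, `τ`. It is imposed for `t > 0` (and `s > 0`), where
`φ'` exists; for `s = 0` it is void. -/
def CondPhi2 (φ : ℝ → ℝ) (D τ : ℝ) : Prop :=
  ∀ s ∈ Ioc (0 : ℝ) 1, ∀ t, 0 < t → s * deriv φ (s * t) ≤ D * s ^ τ * deriv φ t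

/-- Condition `(L2)` with constants `Λ`, `τ`. -/
def CondL2 (l : ℝ → ℝ) (Λ τ : ℝ) : Prop :=
  ∀ s ∈ Icc (0 : ℝ) 1, ∀ t, 0 ≤ t → s ^ (1 + τ) * l t ≤ Λ * l (s * t)

/-- `K(t) = ∫_0^t s φ'(s) / l(s) ds`. -/
def funK (φ l : ℝ → ℝ) (t : ℝ) : ℝ := ∫ s in (0 : ℝ)..t, s * deriv φ s / l s

/-- The inverse `K⁻¹` of `K : [0, ∞) → [0, ∞)`. -/
def invK (φ l : ℝ → ℝ) : ℝ → ℝ := Function.invFunOn (funK φ l) (Ici 0)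

/-- `F(t) = ∫_0^t f(s) ds`. -/
def primF (f : ℝ → ℝ) (t : ℝ) : ℝ := ∫ s in (0 : ℝ)..t, f s

/-- The generalized Keller-Osserman condition `(KO)`: `1 / K⁻¹(F(t)) ∈ L^1(+∞)`. -/
def KellerOsserman (φ f l : ℝ → ℝ) : Prop :=
  IntegrableAtFilter (fun t => 1 / invK φ l (primF f t)) atTop volume

/-- Under `(Φ)`, `(L)`, `(Φ & L)` the function `K` is a bijection of `[0, ∞)`, so that `invK`
is its inverse. -/
theorem funK_bijOn {φ l : ℝ → ℝ} (hφ : CondPhi φ) (hl : CondL l) (h : CondPhiL φ l) :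
    BijOn (funK φ l) (Ici 0) (Ici 0) := by
  set g : ℝ → ℝ := fun s => s * deriv φ s / l s with hg
  have gpos : ∀ s, 0 < s → 0 < g s := fun s hs =>
    div_pos (mul_pos hs (hφ.deriv_pos s hs)) (hl.pos s hs)
  have gcont : ContinuousOn g (Ioi 0) := by
    refine ContinuousOn.div (continuousOn_id.mul ?_) (hl.continuousOn.mono Ioi_subset_Ici_self)
      fun s hs => (hl.pos s hs).ne'
    exact hφ.contDiffOn.continuousOn_deriv_of_isOpen isOpen_Ioi le_rfl
  have gint : ∀ t, 0 ≤ t → IntervalIntegrable g volume 0 t := by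
    intro t ht
    obtain ⟨S, hS, hSi⟩ := h.integrable_zero
    obtain ⟨δ, hδ, hsub⟩ := mem_nhdsGT_iff_exists_Ioc_subset.1 hS
    have h1 : IntervalIntegrable g volume 0 δ :=
      (intervalIntegrable_iff_integrableOn_Ioc_of_le (le_of_lt hδ)).2 (hSi.mono_set hsub)
    rcases ht.eq_or_lt with rfl | ht
    · exact IntervalIntegrable.refl
    · refine h1.trans (ContinuousOn.intervalIntegrable (gcont.mono ?_))
      intro x hx
      exact lt_of_lt_of_le (lt_min hδ ht) hx.1
  have gint' : ∀ a b, 0 ≤ a → 0 ≤ b → IntervalIntegrable g volume a b := fun a b ha hb =>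
    (gint a ha).symm.trans (gint b hb)
  have hK0 : funK φ l 0 = 0 := intervalIntegral.integral_same
  have hsub : ∀ a b, 0 ≤ a → 0 ≤ b → funK φ l b - funK φ l a = ∫ s in a..b, g s :=
    fun a b ha hb => intervalIntegral.integral_interval_sub_left (gint b hb) (gint a ha)
  have hmono : StrictMonoOn (funK φ l) (Ici 0) := by
    intro a ha b hb hab
    have := intervalIntegral.intervalIntegral_pos_of_pos_on (gint' a b ha hb)
      (fun x hx => gpos x (lt_of_le_of_lt ha hx.1)) hab
    rw [← hsub a b ha hb] at this
    linarith
  have hcont : ContinuousOn (funK φ l) (Ici 0) := by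
    intro t ht
    have hc : ContinuousOn (funK φ l) (Icc 0 (t + 1)) := by
      have ht' : (0 : ℝ) ≤ t + 1 := by have : (0 : ℝ) ≤ t := ht; linarith
      exact intervalIntegral.continuousOn_primitive_interval'
        (gint _ ht') left_mem_uIcc |>.mono (by rw [uIcc_of_le ht'])
    refine (hc t ⟨ht, by linarith⟩).mono_of_mem_nhdsWithin ?_
    filter_upwards [self_mem_nhdsWithin, mem_nhdsWithin_of_mem_nhds (Iio_mem_nhds (lt_add_one t))]
      with x hx hx' using ⟨hx, le_of_lt hx'⟩
  have hunb : ∀ y, ∃ t, 0 ≤ t ∧ y ≤ funK φ l t := by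
    by_contra! hb
    obtain ⟨M, hM⟩ := hb
    refine h.not_integrable_top ⟨Ioi 0, Ioi_mem_atTop 0, ?_⟩
    refine integrableOn_Ioi_of_intervalIntegral_norm_bounded M 0
      (b := fun n : ℕ => (n : ℝ)) (l := atTop) (fun n => ?_) tendsto_natCast_atTop_atTop
      (Eventually.of_forall fun n => ?_)
    · exact (intervalIntegrable_iff_integrableOn_Ioc_of_le n.cast_nonneg).1
        (gint n n.cast_nonneg)
    · refine le_trans (le_of_eq ?_) (hM n n.cast_nonneg).le
      refine intervalIntegral.integral_congr_ae (Eventually.of_forall fun x hx => ?_)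
      rw [uIoc_of_le n.cast_nonneg] at hx
      exact (Real.norm_of_nonneg (gpos x hx.1).le)
  refine ⟨fun t ht => ?_, hmono.injOn, fun y hy => ?_⟩
  · have := hmono.monotoneOn self_mem_Ici ht ht
    rwa [hK0] at this
  · obtain ⟨t, ht, hyt⟩ := hunb y
    obtain ⟨x, hx, hxy⟩ := intermediate_value_Icc ht (hcont.mono Icc_subset_Ici_self)
      ⟨by rw [hK0]; exact hy, hyt⟩
    exact ⟨x, hx.1, hxy⟩

end

end HeisenbergLiouville

/-! The core claim is that `u p₁ ≤ u 0` for every `p₁`. Weak solutions are preserved by left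
translations, so any point may play the role of the origin, and the claim forces `u` to be constant.

Suppose `u 0 < ε < η < u p₁`. Solve `K(α') = σ F(α)`, that is `α' = K⁻¹(σ F(α))`, from `α(r₀) = ε`.
Differentiation gives `φ'(α') α'' = σ f(α) l(α')`, and Keller–Osserman says exactly that `α` blows
up at a finite `T`. For small `σ` the curve stays below `η` up to any prescribed radius, and the
first-order term `(2m+1) φ(α') / r` is also absorbed (`exists_barrier`). Composed with the Korányi
gauge, and with the factors `|∇r|` handled by (Φ2) and (L2), it gives a supersolution `v = α(r)` off
the axis `z = 0`, with a factor `1/2` to spare (`radialDiv_le`).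

Since `v` lies below `u` somewhere, is at least `ε > u` near the inner sphere and exceeds `u` near
the outer one, `u - v` has a positive maximum inside the annulus. At a contact point off the axis
the gradients agree, and the spare factor makes the supersolution inequality strict in a
neighbourhood. Testing with a function of `u - v - ν` and using monotonicity of the flux gives a
contradiction (`not_exists_compact_superlevel`, `not_contact_off_axis`).

On the axis `∇v = 0`, and strictness may be lost. The remedy is to move the centre of the barrier
(`exists_center_contact_off_axis`). If every centre near the origin had a contact point on its own
axis, then carrying the centre around a small loop would, by the twist in the group law, bring each
new contact point nearer to the preceding centre. The maximal gap would then strictly decrease all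
the way around a closed loop. -/

namespace HeisenbergLiouville

noncomputable section

variable {m : ℕ}

/-! ### Left translations -/

/-- The left translation `p ↦ a ∘ p` of the Heisenberg group. -/
def leftMul (a p : Heis m) : Heis m :=
  (a.1 + p.1, a.2.1 + p.2.1, a.2.2 + p.2.2 + 2 * ∑ i, (a.2.1 i * p.1 i - a.1 i * p.2.1 i))

/-- The linear part of the left translation by `a`. -/
def leftMulLinear (a : Heis m) : Heis m →L[ℝ] Heis m :=
  LinearMap.toContinuousLinearMap
    { toFun := fun p => (p.1, p.2.1, p.2.2 + 2 * ∑ i, (a.2.1 i * p.1 i - a.1 i * p.2.1 i))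
      map_add' := fun p q => by
        simp only [Prod.fst_add, Prod.snd_add, Pi.add_apply, Prod.mk_add_mk, Prod.mk.injEq,
          true_and]
        have : ∀ i, a.2.1 i * (p.1 i + q.1 i) - a.1 i * (p.2.1 i + q.2.1 i) =
          (a.2.1 i * p.1 i - a.1 i * p.2.1 i) + (a.2.1 i * q.1 i - a.1 i * q.2.1 i) :=
          fun i => by ring
        simp only [this, Finset.sum_add_distrib]
        ring
      map_smul' := fun c p => by
        simp only [Prod.smul_fst, Prod.smul_snd, Pi.smul_apply, smul_eq_mul, RingHom.id_apply,
          Prod.smul_mk, Prod.mk.injEq, true_and]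
        have : ∀ i, a.2.1 i * (c * p.1 i) - a.1 i * (c * p.2.1 i) =
          c * (a.2.1 i * p.1 i - a.1 i * p.2.1 i) := fun i => by ring
        simp only [this, ← Finset.mul_sum]
        ring }

theorem leftMulLinear_apply (a p : Heis m) : leftMulLinear a p =
    (p.1, p.2.1, p.2.2 + 2 * ∑ i, (a.2.1 i * p.1 i - a.1 i * p.2.1 i)) := rfl

theorem leftMul_eq (a p : Heis m) : leftMul a p = a + leftMulLinear a p := by
  rw [leftMulLinear_apply]
  ext <;> simp [leftMul, add_assoc]

theorem hasFDerivAt_leftMul (a p : Heis m) : HasFDerivAt (leftMul a) (leftMulLinear a) p := by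
  have : leftMul a = fun p => a + leftMulLinear a p := funext (leftMul_eq a)
  rw [this]
  exact (leftMulLinear a).hasFDerivAt.const_add a

theorem contDiff_leftMul (a : Heis m) {n : WithTop ℕ∞} : ContDiff ℝ n (leftMul a) := by
  have : leftMul a = fun p => a + leftMulLinear a p := funext (leftMul_eq a)
  rw [this]
  exact contDiff_const.add (leftMulLinear a).contDiff

theorem continuous_leftMul_uncurry : Continuous fun q : Heis m × Heis m => leftMul q.1 q.2 := by
  unfold leftMul
  fun_prop

theorem leftMul_neg_leftMul (a p : Heis m) : leftMul (-a) (leftMul a p) = p := by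
  ext i
  · simp [leftMul]
  · simp [leftMul]
  · simp only [leftMul, Prod.fst_neg, Prod.snd_neg, Pi.neg_apply, Pi.add_apply]
    have : ∀ i, -a.2.1 i * (a.1 i + p.1 i) - -a.1 i * (a.2.1 i + p.2.1 i) =
      -(a.2.1 i * p.1 i - a.1 i * p.2.1 i) := fun i => by ring
    simp only [this, Finset.sum_neg_distrib]
    ring

theorem leftMul_leftMul_neg (a p : Heis m) : leftMul a (leftMul (-a) p) = p := by
  simpa using leftMul_neg_leftMul (-a) p

theorem leftMul_zero_right (a : Heis m) : leftMul a 0 = a := by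
  ext <;> simp [leftMul]

theorem leftMul_zero_left (p : Heis m) : leftMul 0 p = p := by
  ext <;> simp [leftMul]

/-- Left invariance of the frame: since translations are affine, their differential is the same
linear map at every point. -/
theorem leftMulLinear_vecX (a p : Heis m) (j : Fin m) :
    leftMulLinear a (vecX j p) = vecX j (leftMul a p) := by
  rw [leftMulLinear_apply]
  simp only [vecX, leftMul, Pi.zero_apply, mul_zero, sub_zero, Pi.single_apply, mul_ite, mul_one,
    Finset.sum_ite_eq', Finset.mem_univ, if_true, Pi.add_apply, Prod.mk.injEq, true_and]
  ring

theorem leftMulLinear_vecY (a p : Heis m) (j : Fin m) :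
    leftMulLinear a (vecY j p) = vecY j (leftMul a p) := by
  rw [leftMulLinear_apply]
  simp only [vecY, leftMul, Pi.zero_apply, mul_zero, zero_sub, Pi.single_apply, mul_ite, mul_one,
    Finset.sum_neg_distrib,
    Finset.sum_ite_eq', Finset.mem_univ, if_true, Pi.add_apply, Prod.mk.injEq, true_and]
  ring

theorem hgrad_comp_leftMul {u : Heis m → ℝ} (a p : Heis m)
    (hu : DifferentiableAt ℝ u (leftMul a p)) :
    hgrad (fun q => u (leftMul a q)) p = hgrad u (leftMul a p) := by
  have h : fderiv ℝ (fun q => u (leftMul a q)) p =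
      (fderiv ℝ u (leftMul a p)).comp (leftMulLinear a) :=
    (hu.hasFDerivAt.comp p (hasFDerivAt_leftMul a p)).fderiv
  unfold hgrad
  rw [h]
  congr 1
  ext i
  rcases i with j | j
  · simp [leftMulLinear_vecX]
  · simp [leftMulLinear_vecY]

/-- Left translations as homeomorphisms. -/
def leftMulHomeomorph (a : Heis m) : Heis m ≃ₜ Heis m where
  toFun := leftMul a
  invFun := leftMul (-a)
  left_inv := leftMul_neg_leftMul a
  right_inv := leftMul_leftMul_neg a
  continuous_toFun := (contDiff_leftMul a (n := 0)).continuous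
  continuous_invFun := (contDiff_leftMul (-a) (n := 0)).continuous

/-- The translation is triangular: a shift in `x`, then a shift in `y`, then, for fixed `(x, y)`, a
shift in `t` by an amount depending on `(x, y)`. Fubini reduces everything to translation invariance
in each factor. -/
theorem measurePreserving_leftMul (a : Heis m) : MeasurePreserving (leftMul a) volume volume := by
  refine (measurePreserving_add_left volume a.1).skew_product
    (g := fun (x : Fin m → ℝ) (w : (Fin m → ℝ) × ℝ) =>
      ((a.2.1 + w.1, a.2.2 + w.2 + 2 * ∑ i, (a.2.1 i * x i - a.1 i * w.1 i)) : (Fin m → ℝ) × ℝ))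
    (Continuous.measurable (by fun_prop)) (Eventually.of_forall fun x => ?_)
  refine ((measurePreserving_add_left volume a.2.1).skew_product
    (g := fun (y : Fin m → ℝ) (t : ℝ) => a.2.2 + t + 2 * ∑ i, (a.2.1 i * x i - a.1 i * y i))
    (Continuous.measurable (by fun_prop)) (Eventually.of_forall fun y => ?_)).map_eq
  have : (fun t : ℝ => a.2.2 + t + 2 * ∑ i, (a.2.1 i * x i - a.1 i * y i)) =
      fun t => (a.2.2 + 2 * ∑ i, (a.2.1 i * x i - a.1 i * y i)) + t := by
    ext t; ring
  rw [this]
  exact map_add_left_eq_self volume _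

theorem integral_comp_leftMul (a : Heis m) (g : Heis m → ℝ) :
    ∫ p, g (leftMul a p) = ∫ p, g p :=
  (measurePreserving_leftMul a).integral_comp (leftMulHomeomorph a).measurableEmbedding g

/-- Weak solutions are invariant under left translations. -/
theorem IsWeakSolution.comp_leftMul {φ f l : ℝ → ℝ} {u : Heis m → ℝ}
    (hu : IsWeakSolution φ f l u) (a : Heis m) :
    IsWeakSolution φ f l (fun p => u (leftMul a p)) := by
  refine ⟨hu.1.comp (contDiff_leftMul a), fun ζ hζ hc h0 => ?_⟩
  have hd : Differentiable ℝ u := hu.1.differentiable one_ne_zero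
  have hζd : Differentiable ℝ ζ := hζ.differentiable (by simp)
  -- Test the original inequality with the test function carried back by the inverse translation,
  -- then change variables on both sides.
  have key := hu.2 (fun p => ζ (leftMul (-a) p)) (hζ.comp (contDiff_leftMul (-a)))
    (hc.comp_homeomorph (leftMulHomeomorph (-a))) (fun q => h0 _)
  rw [← integral_comp_leftMul a, ← integral_comp_leftMul a (fun q => ‖hgrad u q‖⁻¹ * _ * _)] at key
  simpa only [hgrad_comp_leftMul a _ (hd _), hgrad_comp_leftMul (-a) _ (hζd _),
    leftMul_neg_leftMul] using key

/-! ### Mollification of test functions -/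

theorem norm_le_three_mul_of_dist_le {F : Type*} [SeminormedAddCommGroup F] {a c : F} {M : ℝ}
    (h : dist c a ≤ 2 * M) (ha : ‖a‖ ≤ M) : ‖c‖ ≤ 3 * M := by
  rw [dist_comm, dist_eq_norm] at h
  linarith [norm_le_insert a c]

/-- A nonnegative compactly supported `C^1` function is the limit, together with its derivative,
of a dominated sequence of nonnegative smooth functions supported in a fixed compact set. -/
theorem exists_seq_smooth_approx {E : Type*} [NormedAddCommGroup E] [NormedSpace ℝ E]
    [FiniteDimensional ℝ E] {w : E → ℝ} (hw : ContDiff ℝ 1 w) (hc : HasCompactSupport w)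
    (h0 : ∀ x, 0 ≤ w x) :
    ∃ (ζ : ℕ → E → ℝ) (K : Set E) (M : ℝ), IsCompact K ∧ (∀ n, ContDiff ℝ ∞ (ζ n) ∧
      tsupport (ζ n) ⊆ K ∧ (∀ x, 0 ≤ ζ n x) ∧ (∀ x, ‖ζ n x‖ ≤ M) ∧
      (∀ x, ‖fderiv ℝ (ζ n) x‖ ≤ M)) ∧
      ∀ x, Tendsto (fun n => ζ n x) atTop (𝓝 (w x)) ∧
        Tendsto (fun n => fderiv ℝ (ζ n) x) atTop (𝓝 (fderiv ℝ w x)) := by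
  borelize E
  let μ : Measure E := Measure.addHaar
  let b : ℕ → ContDiffBump (0 : E) := fun n =>
    ⟨1 / ((n : ℝ) + 2), 1 / ((n : ℝ) + 1), by positivity, by gcongr; norm_num⟩
  have hb : Tendsto (fun n => (b n).rOut) atTop (𝓝 0) := tendsto_one_div_add_atTop_nhds_zero_nat
  have hb1 : ∀ n, (b n).rOut ≤ 1 := fun n => by
    change 1 / ((n : ℝ) + 1) ≤ 1
    rw [div_le_one (by positivity)]
    have : (0 : ℝ) ≤ n := n.cast_nonneg
    linarith
  have hwc : Continuous w := hw.continuous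
  have hdc : Continuous (fderiv ℝ w) := hw.continuous_fderiv one_ne_zero
  let L : ℝ →L[ℝ] ℝ →L[ℝ] ℝ := ContinuousLinearMap.lsmul ℝ ℝ
  let L' : ℝ →L[ℝ] (E →L[ℝ] ℝ) →L[ℝ] (E →L[ℝ] ℝ) := ContinuousLinearMap.lsmul ℝ ℝ
  let ζ : ℕ → E → ℝ := fun n => MeasureTheory.convolution ((b n).normed μ) w L μ
  have hLL : L.precompR E = L' := by
    ext c T
    simp [L, L', ContinuousLinearMap.precompR_apply]
  have hder : ∀ n x, HasFDerivAt (ζ n)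
      (MeasureTheory.convolution ((b n).normed μ) (fderiv ℝ w) L' μ x) x := by
    intro n x
    rw [← hLL]
    exact hc.hasFDerivAt_convolution_right L
      ((b n).continuous_normed.locallyIntegrable) hw x
  obtain ⟨M, hM⟩ := hwc.bounded_above_of_compact_support hc
  obtain ⟨M', hM'⟩ := hdc.bounded_above_of_compact_support (hc.fderiv (𝕜 := ℝ))
  refine ⟨ζ, Metric.cthickening 1 (tsupport w), max (3 * M) (3 * M'), hc.isCompact.cthickening,
    fun n => ⟨?_, ?_, ?_, ?_, ?_⟩, fun x => ⟨?_, ?_⟩⟩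
  · exact (b n).hasCompactSupport_normed.contDiff_convolution_left L (b n).contDiff_normed
      hwc.locallyIntegrable
  · refine closure_minimal ?_ Metric.isClosed_cthickening
    refine (support_convolution_subset L).trans ?_
    rintro _ ⟨y, hy, z, hz, rfl⟩
    rw [(b n).support_normed_eq] at hy
    refine Metric.mem_cthickening_of_dist_le (y + z) z 1 _ (subset_tsupport w hz) ?_
    rw [dist_eq_norm, add_sub_cancel_right, ← dist_zero_right]
    exact (Metric.mem_ball.1 hy).le.trans (hb1 n)
  · intro x
    exact integral_nonneg fun t => mul_nonneg ((b n).nonneg_normed t) (h0 _)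
  · intro x
    refine le_trans (norm_le_three_mul_of_dist_le (a := w x) ?_ (hM x)) (le_max_left _ _)
    refine (b n).dist_normed_convolution_le hwc.aestronglyMeasurable fun y _ => ?_
    refine (dist_le_norm_add_norm _ _).trans ?_
    linarith [hM x, hM y]
  · intro x
    rw [(hder n x).fderiv]
    refine le_trans (norm_le_three_mul_of_dist_le (a := fderiv ℝ w x) ?_ (hM' x)) (le_max_right _ _)
    refine (b n).dist_normed_convolution_le hdc.aestronglyMeasurable fun y _ => ?_
    refine (dist_le_norm_add_norm _ _).trans ?_
    linarith [hM' x, hM' y]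
  · exact ContDiffBump.convolution_tendsto_right_of_continuous hb hwc x
  · refine (ContDiffBump.convolution_tendsto_right_of_continuous (μ := μ) hb hdc x).congr
      fun n => ?_
    exact (hder n x).fderiv.symm

/-! ### The horizontal gradient -/

/-- The vector of `ℝ^{2m+1}` with components `V` in the frame `X_j`, `Y_j` at `q`. -/
def hlift (q : Heis m) (V : EuclideanSpace ℝ (Fin m ⊕ Fin m)) : Heis m :=
  (fun j => V (Sum.inl j), fun j => V (Sum.inr j),
    2 * ∑ j, (V (Sum.inl j) * q.2.1 j - V (Sum.inr j) * q.1 j))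

theorem hlift_eq (q : Heis m) (V : EuclideanSpace ℝ (Fin m ⊕ Fin m)) :
    hlift q V = ∑ j, V (Sum.inl j) • vecX j q + ∑ j, V (Sum.inr j) • vecY j q := by
  refine Prod.ext ?_ (Prod.ext ?_ ?_)
  · ext i
    simp [hlift, vecX, vecY, Prod.fst_sum, Finset.sum_apply, Pi.single_apply]
  · ext i
    simp [hlift, vecX, vecY, Prod.fst_sum, Prod.snd_sum, Finset.sum_apply, Pi.single_apply]
  · simp only [hlift, vecX, vecY, Prod.snd_add, Prod.snd_sum, Prod.smul_snd, smul_eq_mul,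
      ← Finset.sum_add_distrib, Finset.mul_sum]
    exact Finset.sum_congr rfl fun i _ => by ring

/-- Turns horizontal pairings into ordinary directional derivatives, so that Euclidean limit and
integration-by-parts theorems apply. -/
theorem inner_hgrad (ζ : Heis m → ℝ) (q : Heis m) (V : EuclideanSpace ℝ (Fin m ⊕ Fin m)) :
    inner ℝ V (hgrad ζ q) = fderiv ℝ ζ q (hlift q V) := by
  rw [hlift_eq, map_add, map_sum, map_sum, PiLp.inner_apply, Fintype.sum_sum_type]
  simp [hgrad, mul_comm]

theorem continuous_hgrad {u : Heis m → ℝ} (hu : ContDiff ℝ 1 u) : Continuous (hgrad u) := by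
  have hd : Continuous (fderiv ℝ u) := hu.continuous_fderiv one_ne_zero
  refine (PiLp.continuous_toLp 2 _).comp (continuous_pi fun i => ?_)
  rcases i with j | j
  · exact hd.clm_apply (by unfold vecX; fun_prop)
  · exact hd.clm_apply (by unfold vecY; fun_prop)

theorem continuous_hlift {V : Heis m → EuclideanSpace ℝ (Fin m ⊕ Fin m)} (hV : Continuous V) :
    Continuous fun q => hlift q (V q) := by
  unfold hlift
  fun_prop

/-! ### The nonlinearity `V ↦ |V|⁻¹ φ(|V|) V` -/

section Flux

variable {H : Type*} [NormedAddCommGroup H] [InnerProductSpace ℝ H] {φ : ℝ → ℝ}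

/-- The vector `|V|⁻¹ φ(|V|) V`. -/
def flux (φ : ℝ → ℝ) (V : H) : H := (‖V‖⁻¹ * φ ‖V‖) • V

theorem norm_flux_le (V : H) : ‖flux φ V‖ ≤ |φ ‖V‖| := by
  rw [flux, norm_smul, norm_mul, norm_inv, norm_norm, Real.norm_eq_abs]
  rcases eq_or_ne ‖V‖ 0 with h | h
  · simp [h]
  · rw [mul_right_comm, inv_mul_cancel₀ h, one_mul]

theorem continuous_flux (hφ : ContinuousOn φ (Ici 0)) (h0 : φ 0 = 0) :
    Continuous (flux φ : H → H) := by
  have hc : Continuous fun V : H => φ ‖V‖ :=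
    hφ.comp_continuous continuous_norm fun V => norm_nonneg V
  refine continuous_iff_continuousAt.2 fun V => ?_
  rcases eq_or_ne V 0 with rfl | hV
  · have : flux φ (0 : H) = 0 := by simp [flux]
    rw [ContinuousAt, this]
    refine squeeze_zero_norm (fun V => norm_flux_le V) ?_
    have := hc.abs.tendsto (0 : H)
    simpa [h0] using this
  · exact ((continuousAt_id.norm.inv₀ (norm_ne_zero_iff.2 hV)).mul hc.continuousAt).smul
      continuousAt_id

/-- The monotonicity of `V ↦ |V|⁻¹ φ(|V|) V`. -/
theorem inner_flux_sub_flux_nonneg (hφ : MonotoneOn φ (Ici 0)) (h0 : φ 0 = 0) (V W : H) :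
    0 ≤ inner ℝ (flux φ V - flux φ W) (V - W) := by
  have hpos : ∀ t, 0 ≤ t → 0 ≤ φ t := fun t ht => h0 ▸ hφ self_mem_Ici ht ht
  have key : ∀ V : H, ‖V‖⁻¹ * φ ‖V‖ * (‖V‖ * ‖V‖) = φ ‖V‖ * ‖V‖ := by
    intro V
    rcases eq_or_ne ‖V‖ 0 with h | h
    · simp [h]
    · field_simp
  have key2 : ∀ V : H, ‖V‖⁻¹ * φ ‖V‖ * ‖V‖ = φ ‖V‖ := by
    intro V
    rcases eq_or_ne ‖V‖ 0 with h | h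
    · simp [h, h0]
    · field_simp
  have hmono : 0 ≤ (φ ‖V‖ - φ ‖W‖) * (‖V‖ - ‖W‖) := by
    rcases le_total ‖V‖ ‖W‖ with h | h
    · exact mul_nonneg_of_nonpos_of_nonpos
        (sub_nonpos.2 (hφ (norm_nonneg V) (norm_nonneg W) h)) (sub_nonpos.2 h)
    · exact mul_nonneg (sub_nonneg.2 (hφ (norm_nonneg W) (norm_nonneg V) h)) (sub_nonneg.2 h)
  have ha : 0 ≤ ‖V‖⁻¹ * φ ‖V‖ := mul_nonneg (by positivity) (hpos _ (norm_nonneg V))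
  have hb : 0 ≤ ‖W‖⁻¹ * φ ‖W‖ := mul_nonneg (by positivity) (hpos _ (norm_nonneg W))
  have hVW : inner ℝ V W ≤ ‖V‖ * ‖W‖ := real_inner_le_norm V W
  have hk1 := key V
  have hk2 := key W
  have hl1 := key2 V
  have hl2 := key2 W
  -- Both coefficients are nonnegative, so Cauchy–Schwarz on the cross term bounds the expression
  -- below by `(φ|V| - φ|W|)(|V| - |W|)`.
  have expand : inner ℝ (flux φ V - flux φ W) (V - W) =
      ‖V‖⁻¹ * φ ‖V‖ * (‖V‖ * ‖V‖) + ‖W‖⁻¹ * φ ‖W‖ * (‖W‖ * ‖W‖) -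
        (‖V‖⁻¹ * φ ‖V‖ + ‖W‖⁻¹ * φ ‖W‖) * inner ℝ V W := by
    simp only [flux, inner_sub_left, inner_sub_right, real_inner_smul_left,
      real_inner_self_eq_norm_mul_norm, real_inner_comm V W]
    ring
  rw [expand, hk1, hk2]
  have h1 := mul_le_mul_of_nonneg_left hVW (add_nonneg ha hb)
  have h2 : (‖V‖⁻¹ * φ ‖V‖ + ‖W‖⁻¹ * φ ‖W‖) * (‖V‖ * ‖W‖) = φ ‖V‖ * ‖W‖ + φ ‖W‖ * ‖V‖ := by
    linear_combination ‖W‖ * hl1 + ‖V‖ * hl2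
  nlinarith

end Flux

theorem CondPhi.monotoneOn {φ : ℝ → ℝ} (hφ : CondPhi φ) : MonotoneOn φ (Ici 0) :=
  (strictMonoOn_of_deriv_pos (convex_Ici 0) hφ.continuousOn fun t ht => hφ.deriv_pos t
    (by simpa using ht)).monotoneOn

/-- The weak inequality holds for compactly supported test functions of class `C^1`. -/
theorem IsWeakSolution.integral_le {φ f l : ℝ → ℝ} {u : Heis m → ℝ}
    (hu : IsWeakSolution φ f l u) (hφ : CondPhi φ) (hf : ContinuousOn f (Ici 0))
    (hl : ContinuousOn l (Ici 0)) (hu0 : ∀ q, 0 ≤ u q) {w : Heis m → ℝ} (hw : ContDiff ℝ 1 w)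
    (hc : HasCompactSupport w) (h0 : ∀ q, 0 ≤ w q) :
    ∫ q, f (u q) * l ‖hgrad u q‖ * w q ≤
      -∫ q, fderiv ℝ w q (hlift q (flux φ (hgrad u q))) := by
  obtain ⟨ζ, K, M, hK, hζ, hlim⟩ := exists_seq_smooth_approx hw hc h0
  have hZ : Continuous fun q => hlift q (flux φ (hgrad u q)) :=
    continuous_hlift ((continuous_flux hφ.continuousOn hφ.map_zero).comp (continuous_hgrad hu.1))
  have hA : Continuous fun q => f (u q) * l ‖hgrad u q‖ :=
    (hf.comp_continuous hu.1.continuous hu0).mul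
      (hl.comp_continuous (continuous_hgrad hu.1).norm fun q => norm_nonneg _)
  have hKm : MeasurableSet K := hK.measurableSet
  have hlim1 : Tendsto (fun n => ∫ q, f (u q) * l ‖hgrad u q‖ * ζ n q) atTop
      (𝓝 (∫ q, f (u q) * l ‖hgrad u q‖ * w q)) := by
    refine tendsto_integral_of_dominated_convergence
      (K.indicator fun q => ‖f (u q) * l ‖hgrad u q‖‖ * M) (fun n => ?_) ?_ (fun n => ?_) ?_
    · exact (hA.mul (hζ n).1.continuous).aestronglyMeasurable
    · exact ((hA.norm.mul continuous_const).continuousOn.integrableOn_compact hK).integrable_indicator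
        hKm
    · refine Eventually.of_forall fun q => ?_
      by_cases hq : q ∈ K
      · rw [indicator_of_mem hq, norm_mul]
        exact mul_le_mul_of_nonneg_left ((hζ n).2.2.2.1 q) (norm_nonneg _)
      · have : ζ n q = 0 := image_eq_zero_of_notMem_tsupport fun h => hq ((hζ n).2.1 h)
        simp [this, indicator_of_notMem hq]
    · exact Eventually.of_forall fun q => (hlim q).1.const_mul _
  have hlim2 : Tendsto (fun n => ∫ q, fderiv ℝ (ζ n) q (hlift q (flux φ (hgrad u q)))) atTop
      (𝓝 (∫ q, fderiv ℝ w q (hlift q (flux φ (hgrad u q))))) := by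
    refine tendsto_integral_of_dominated_convergence
      (K.indicator fun q => M * ‖hlift q (flux φ (hgrad u q))‖) (fun n => ?_) ?_ (fun n => ?_) ?_
    · exact (((hζ n).1.continuous_fderiv (by simp)).clm_apply hZ).aestronglyMeasurable
    · exact ((continuous_const.mul hZ.norm).continuousOn.integrableOn_compact hK).integrable_indicator
        hKm
    · refine Eventually.of_forall fun q => ?_
      by_cases hq : q ∈ K
      · rw [indicator_of_mem hq]
        exact (ContinuousLinearMap.le_opNorm _ _).trans
          (mul_le_mul_of_nonneg_right ((hζ n).2.2.2.2 q) (norm_nonneg _))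
      · have : fderiv ℝ (ζ n) q = 0 :=
          image_eq_zero_of_notMem_tsupport fun h => hq ((hζ n).2.1 (tsupport_fderiv_subset ℝ h))
        simp [this, indicator_of_notMem hq]
    · exact Eventually.of_forall fun q =>
        ((ContinuousLinearMap.apply ℝ ℝ _).continuous.tendsto _).comp (hlim q).2
  refine le_of_tendsto_of_tendsto' hlim1 hlim2.neg fun n => ?_
  have := hu.2 (ζ n) (hζ n).1 (HasCompactSupport.of_support_subset_isCompact hK
    ((subset_tsupport _).trans (hζ n).2.1)) (hζ n).2.2.1
  refine this.trans (le_of_eq ?_)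
  congr 1
  refine integral_congr_ae (Eventually.of_forall fun q => ?_)
  change _ = fderiv ℝ (ζ n) q (hlift q (flux φ (hgrad u q)))
  rw [← inner_hgrad, flux, real_inner_smul_left]

/-! ### The Korányi gauge -/

/-- `|z|² = |x|² + |y|²`. -/
def zsq (p : Heis m) : ℝ := ∑ i, (p.1 i ^ 2 + p.2.1 i ^ 2)

/-- `|z|⁴ + t²`, the fourth power of the Korányi gauge. -/
def gaugePow (p : Heis m) : ℝ := zsq p ^ 2 + p.2.2 ^ 2

/-- The Korányi gauge `(|z|⁴ + t²)^{1/4}`. -/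
def gauge (p : Heis m) : ℝ := √√(gaugePow p)

/-- A quarter of the horizontal gradient of `|z|⁴ + t²`. -/
def gaugeGrad (p : Heis m) : EuclideanSpace ℝ (Fin m ⊕ Fin m) :=
  WithLp.toLp 2 (Sum.elim (fun j => zsq p * p.1 j + p.2.2 * p.2.1 j)
    (fun j => zsq p * p.2.1 j - p.2.2 * p.1 j))

theorem zsq_nonneg (p : Heis m) : 0 ≤ zsq p := Finset.sum_nonneg fun i _ => by positivity

theorem gaugePow_nonneg (p : Heis m) : 0 ≤ gaugePow p := by unfold gaugePow; positivity

theorem gauge_nonneg (p : Heis m) : 0 ≤ gauge p := Real.sqrt_nonneg _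

theorem gauge_sq (p : Heis m) : gauge p ^ 2 = √(gaugePow p) := Real.sq_sqrt (Real.sqrt_nonneg _)

theorem gauge_pow_four (p : Heis m) : gauge p ^ 4 = gaugePow p := by
  rw [show 4 = 2 * 2 from rfl, pow_mul, gauge_sq, Real.sq_sqrt (gaugePow_nonneg p)]

theorem contDiff_zsq {n : WithTop ℕ∞} : ContDiff ℝ n (zsq : Heis m → ℝ) := by
  unfold zsq
  fun_prop

theorem contDiff_gaugePow {n : WithTop ℕ∞} : ContDiff ℝ n (gaugePow : Heis m → ℝ) := by
  unfold gaugePow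
  exact (contDiff_zsq.pow 2).add (by fun_prop)

theorem continuous_gauge : Continuous (gauge : Heis m → ℝ) :=
  (contDiff_gaugePow (n := 0)).continuous.sqrt.sqrt

theorem gaugePow_pos {p : Heis m} (hp : 0 < gauge p) : 0 < gaugePow p := by
  rw [← gauge_pow_four]; positivity

theorem contDiffAt_gauge {p : Heis m} (hp : 0 < gauge p) {n : WithTop ℕ∞} :
    ContDiffAt ℝ n gauge p := by
  have h := gaugePow_pos hp
  exact (contDiff_gaugePow.contDiffAt.sqrt h.ne').sqrt (Real.sqrt_pos.2 h).ne'

theorem zsq_le_gauge_sq (p : Heis m) : zsq p ≤ gauge p ^ 2 := by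
  rw [gauge_sq]
  refine Real.le_sqrt_of_sq_le ?_
  unfold gaugePow
  nlinarith [sq_nonneg p.2.2]

/-- The closed gauge balls are compact. -/
theorem isCompact_gauge_le (T : ℝ) : IsCompact {p : Heis m | gauge p ≤ T} := by
  refine Metric.isCompact_of_isClosed_isBounded
    (isClosed_le continuous_gauge continuous_const) ?_
  refine (Metric.isBounded_closedBall (x := (0 : Heis m)) (r := T ^ 2 + T + 1)).subset ?_
  intro p (hp : gauge p ≤ T)
  have hg := gauge_nonneg p
  have hz := zsq_le_gauge_sq p
  have hT : gauge p ^ 2 ≤ T ^ 2 := by gcongr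
  have hc : ∀ i, p.1 i ^ 2 + p.2.1 i ^ 2 ≤ T ^ 2 := fun i =>
    (Finset.single_le_sum (f := fun i => p.1 i ^ 2 + p.2.1 i ^ 2)
      (fun i _ => by positivity) (Finset.mem_univ i)).trans (hz.trans hT)
  have habs : ∀ s : ℝ, s ^ 2 ≤ T ^ 2 → |s| ≤ T := fun s hs =>
    abs_le_of_sq_le_sq hs (hg.trans hp)
  have hb : T ≤ T ^ 2 + T + 1 := by nlinarith
  rw [mem_closedBall_zero_iff, Prod.norm_def, Prod.norm_def]
  refine max_le ?_ (max_le ?_ ?_)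
  · refine (pi_norm_le_iff_of_nonneg (by nlinarith)).2 fun i => ?_
    exact (habs _ (by nlinarith [hc i, sq_nonneg (p.2.1 i)])).trans hb
  · refine (pi_norm_le_iff_of_nonneg (by nlinarith)).2 fun i => ?_
    exact (habs _ (by nlinarith [hc i, sq_nonneg (p.1 i)])).trans hb
  · have : |p.2.2| ≤ √(gaugePow p) := by
      refine Real.abs_le_sqrt ?_
      unfold gaugePow
      nlinarith [sq_nonneg (zsq p)]
    rw [← gauge_sq] at this
    rw [Real.norm_eq_abs]
    nlinarith

/-! ### Horizontal gradient of the gauge and of radial functions -/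

theorem norm_gaugeGrad_sq (p : Heis m) : ‖gaugeGrad p‖ ^ 2 = zsq p * gaugePow p := by
  rw [EuclideanSpace.norm_sq_eq, Fintype.sum_sum_type, ← Finset.sum_add_distrib]
  have : ∀ i, ‖gaugeGrad p (Sum.inl i)‖ ^ 2 + ‖gaugeGrad p (Sum.inr i)‖ ^ 2 =
      (p.1 i ^ 2 + p.2.1 i ^ 2) * gaugePow p := fun i => by
    simp only [gaugeGrad, Real.norm_eq_abs, sq_abs, Sum.elim_inl, Sum.elim_inr, gaugePow]
    ring
  simp only [this, ← Finset.sum_mul]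
  rfl

theorem hlift_gaugeGrad (p : Heis m) : hlift p (gaugeGrad p) =
    (zsq p • p.1 + p.2.2 • p.2.1, zsq p • p.2.1 - p.2.2 • p.1, 2 * p.2.2 * zsq p) := by
  refine Prod.ext ?_ (Prod.ext ?_ ?_)
  · ext i; simp [hlift, gaugeGrad]
  · ext i; simp [hlift, gaugeGrad]
  · simp only [hlift, gaugeGrad, Sum.elim_inl, Sum.elim_inr]
    have : ∀ i, (zsq p * p.1 i + p.2.2 * p.2.1 i) * p.2.1 i -
        (zsq p * p.2.1 i - p.2.2 * p.1 i) * p.1 i = p.2.2 * (p.1 i ^ 2 + p.2.1 i ^ 2) :=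
      fun i => by ring
    simp only [this, ← Finset.mul_sum]
    change 2 * (p.2.2 * zsq p) = _
    ring

theorem continuous_gaugeField : Continuous fun p : Heis m => hlift p (gaugeGrad p) := by
  refine continuous_hlift ((PiLp.continuous_toLp 2 _).comp (continuous_pi fun i => ?_))
  have hz : Continuous (zsq : Heis m → ℝ) := (contDiff_zsq (n := 0)).continuous
  rcases i with j | j
  · simp only [Sum.elim_inl]; fun_prop
  · simp only [Sum.elim_inr]; fun_prop

theorem hasDerivAt_zsq_line (p v : Heis m) :
    HasDerivAt (fun s : ℝ => zsq (p + s • v)) (2 * ∑ i, (p.1 i * v.1 i + p.2.1 i * v.2.1 i)) 0 := by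
  have h1 : ∀ a b : ℝ, HasDerivAt (fun s : ℝ => a + s * b) b 0 := fun a b => by
    simpa using ((hasDerivAt_id (0 : ℝ)).mul_const b).const_add a
  have h := HasDerivAt.fun_sum (u := Finset.univ) fun i _ =>
    ((h1 (p.1 i) (v.1 i)).pow 2).add ((h1 (p.2.1 i) (v.2.1 i)).pow 2)
  convert! h using 1
  · rw [Finset.mul_sum]
    refine Finset.sum_congr rfl fun i _ => ?_
    simp
    ring

theorem hasDerivAt_gaugePow_line (p v : Heis m) :
    HasDerivAt (fun s : ℝ => gaugePow (p + s • v))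
      (4 * zsq p * ∑ i, (p.1 i * v.1 i + p.2.1 i * v.2.1 i) + 2 * p.2.2 * v.2.2) 0 := by
  have h1 : HasDerivAt (fun s : ℝ => p.2.2 + s * v.2.2) v.2.2 0 := by
    simpa using ((hasDerivAt_id (0 : ℝ)).mul_const v.2.2).const_add p.2.2
  have h := ((hasDerivAt_zsq_line p v).pow 2).add (h1.pow 2)
  convert! h using 1
  simp
  ring

/-- Reduces each directional derivative below to one-variable calculus along a line. -/
theorem fderiv_apply_eq_of_line {g : Heis m → ℝ} {p v : Heis m} {d : ℝ}
    (hg : DifferentiableAt ℝ g p) (h : HasDerivAt (fun s : ℝ => g (p + s • v)) d 0) :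
    fderiv ℝ g p v = d := by
  have h2 : HasLineDerivAt ℝ g (fderiv ℝ g p v) p v := hg.hasFDerivAt.hasLineDerivAt v
  exact HasDerivAt.unique h2 h

theorem hasDerivAt_zsq_gaugeField (p : Heis m) :
    HasDerivAt (fun s : ℝ => zsq (p + s • hlift p (gaugeGrad p))) (2 * zsq p ^ 2) 0 := by
  convert hasDerivAt_zsq_line p (hlift p (gaugeGrad p)) using 1
  rw [hlift_gaugeGrad, pow_two]
  nth_rw 2 [zsq]
  rw [Finset.mul_sum]
  congr 1
  exact Finset.sum_congr rfl fun i _ => by simp; ring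

theorem hasDerivAt_gaugePow_gaugeField (p : Heis m) :
    HasDerivAt (fun s : ℝ => gaugePow (p + s • hlift p (gaugeGrad p)))
      (4 * zsq p * gaugePow p) 0 := by
  convert hasDerivAt_gaugePow_line p (hlift p (gaugeGrad p)) using 1
  have : ∑ i, (p.1 i * (hlift p (gaugeGrad p)).1 i + p.2.1 i * (hlift p (gaugeGrad p)).2.1 i) =
      zsq p ^ 2 := by
    rw [hlift_gaugeGrad]
    have : zsq p ^ 2 = zsq p * ∑ i, (p.1 i ^ 2 + p.2.1 i ^ 2) := pow_two _
    rw [this, Finset.mul_sum]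
    exact Finset.sum_congr rfl fun i _ => by simp; ring
  rw [this, hlift_gaugeGrad, gaugePow]
  ring

theorem hgrad_gaugePow (p : Heis m) : hgrad gaugePow p = (4 : ℝ) • gaugeGrad p := by
  have hd : DifferentiableAt ℝ (gaugePow : Heis m → ℝ) p :=
    (contDiff_gaugePow (n := 1)).differentiable one_ne_zero p
  ext i
  rcases i with j | j
  · simp only [hgrad, Sum.elim_inl, fderiv_apply_eq_of_line hd (hasDerivAt_gaugePow_line p _)]
    simp [vecX, gaugeGrad, Pi.single_apply]
    ring
  · simp only [hgrad, Sum.elim_inr, fderiv_apply_eq_of_line hd (hasDerivAt_gaugePow_line p _)]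
    simp [vecY, gaugeGrad, Pi.single_apply]
    ring

theorem hasFDerivAt_gauge {p : Heis m} (hp : 0 < gauge p) :
    HasFDerivAt gauge ((1 / (4 * gauge p ^ 3)) • fderiv ℝ gaugePow p) p := by
  have h := gaugePow_pos hp
  have hd : HasFDerivAt (gaugePow : Heis m → ℝ) (fderiv ℝ gaugePow p) p :=
    ((contDiff_gaugePow (n := 1)).differentiable one_ne_zero p).hasFDerivAt
  convert! (hd.sqrt h.ne').sqrt (Real.sqrt_pos.2 h).ne' using 1
  rw [smul_smul, ← gauge_sq, Real.sqrt_sq hp.le]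
  congr 1
  field_simp
  norm_num

theorem hgrad_radial {α : ℝ → ℝ} {b : ℝ} {p : Heis m} (hp : 0 < gauge p)
    (hα : HasDerivAt α b (gauge p)) :
    hgrad (fun q => α (gauge q)) p = (b / gauge p ^ 3) • gaugeGrad p := by
  have h : HasFDerivAt (fun q : Heis m => α (gauge q))
      (b • (1 / (4 * gauge p ^ 3)) • fderiv ℝ gaugePow p) p :=
    hα.comp_hasFDerivAt p (hasFDerivAt_gauge hp)
  have h2 : hgrad (fun q => α (gauge q)) p = (b * (1 / (4 * gauge p ^ 3))) • hgrad gaugePow p := by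
    ext i
    rcases i with j | j <;> simp [hgrad, h.fderiv] <;> ring
  rw [h2, hgrad_gaugePow, smul_smul]
  congr 1
  field_simp

theorem norm_gaugeGrad (p : Heis m) : ‖gaugeGrad p‖ = √(zsq p) * gauge p ^ 2 := by
  rw [gauge_sq, ← Real.sqrt_mul (zsq_nonneg p), ← norm_gaugeGrad_sq, Real.sqrt_sq (norm_nonneg _)]

/-- The factor `|∇r| = |z| / r` lies in `[0, 1]` and vanishes on the axis. It is the source of both
the scaling conditions (Φ2), (L2) and the trouble at axis points. -/
theorem norm_hgrad_radial {α : ℝ → ℝ} {b : ℝ} {p : Heis m} (hp : 0 < gauge p) (hb : 0 ≤ b)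
    (hα : HasDerivAt α b (gauge p)) :
    ‖hgrad (fun q => α (gauge q)) p‖ = √(zsq p) / gauge p * b := by
  rw [hgrad_radial hp hα, norm_smul, norm_gaugeGrad, Real.norm_of_nonneg (by positivity)]
  field_simp

/-- Writing the flux as a scalar times a fixed polynomial field means that its divergence requires
differentiating only that scalar. -/
theorem flux_hgrad_radial {φ α : ℝ → ℝ} {b : ℝ} {p : Heis m} (hp : 0 < gauge p) (hb : 0 < b)
    (hz : 0 < zsq p) (hα : HasDerivAt α b (gauge p)) :
    flux φ (hgrad (fun q => α (gauge q)) p) =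
      (φ (√(zsq p) / gauge p * b) / (√(zsq p) * gauge p ^ 2)) • gaugeGrad p := by
  have hs : 0 < √(zsq p) := Real.sqrt_pos.2 hz
  rw [flux, norm_hgrad_radial hp hb.le hα, hgrad_radial hp hα, smul_smul]
  congr 1
  field_simp

/-! ### The divergence of the flux of a radial function -/

instance : (volume : Measure (Heis m)).IsAddHaarMeasure :=
  haveI : (volume : Measure ((Fin m → ℝ) × ℝ)).IsAddHaarMeasure :=
    Measure.prod.instIsAddHaarMeasure volume volume
  Measure.prod.instIsAddHaarMeasure volume volume

theorem integrable_mul_of_hasCompactSupport {g h : Heis m → ℝ} (hg : Continuous g)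
    (hc : HasCompactSupport g) (hh : Continuous h) : Integrable (fun p => h p * g p) :=
  (hh.mul hg).integrable_of_hasCompactSupport hc.mul_left

theorem integral_mul_fderiv {g h : Heis m → ℝ} (hg : ContDiff ℝ 1 g) (hc : HasCompactSupport g)
    (hh : ContDiff ℝ 1 h) (v : Heis m) :
    Integrable (fun p => h p * fderiv ℝ g p v) ∧ Integrable (fun p => fderiv ℝ h p v * g p) ∧
    ∫ p, h p * fderiv ℝ g p v = -∫ p, fderiv ℝ h p v * g p := by
  have hg' : Continuous fun p => fderiv ℝ g p v :=
    (hg.continuous_fderiv one_ne_zero).clm_apply continuous_const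
  have hh' : Continuous fun p => fderiv ℝ h p v :=
    (hh.continuous_fderiv one_ne_zero).clm_apply continuous_const
  have i1 := integrable_mul_of_hasCompactSupport hg' (hc.fderiv_apply (𝕜 := ℝ) v) hh.continuous
  have i2 := integrable_mul_of_hasCompactSupport hg.continuous hc hh'
  exact ⟨i1, i2, integral_mul_fderiv_eq_neg_fderiv_mul_of_integrable i2 i1
    (integrable_mul_of_hasCompactSupport hg.continuous hc hh.continuous)
    (fun x _ => hh.differentiable one_ne_zero x) (fun x _ => hg.differentiable one_ne_zero x)⟩

theorem fderiv_gaugeField_comp_x (p : Heis m) (j : Fin m) :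
    fderiv ℝ (fun q : Heis m => zsq q * q.1 j + q.2.2 * q.2.1 j) p (Pi.single j 1, 0, 0) =
      2 * p.1 j ^ 2 + zsq p := by
  refine fderiv_apply_eq_of_line (((contDiff_zsq (n := 1)).differentiable one_ne_zero p).mul
    (by fun_prop) |>.add (by fun_prop)) ?_
  have h1 : HasDerivAt (fun s : ℝ => p.1 j + s) 1 0 := by
    simpa using (hasDerivAt_id (0 : ℝ)).const_add (p.1 j)
  have h := ((hasDerivAt_zsq_line p (Pi.single j 1, 0, 0)).mul h1).add_const (p.2.2 * p.2.1 j)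
  convert! h using 1
  · ext s
    simp
  · simp [Pi.single_apply]
    ring

theorem fderiv_gaugeField_comp_y (p : Heis m) (j : Fin m) :
    fderiv ℝ (fun q : Heis m => zsq q * q.2.1 j - q.2.2 * q.1 j) p (0, Pi.single j 1, 0) =
      2 * p.2.1 j ^ 2 + zsq p := by
  refine fderiv_apply_eq_of_line (((contDiff_zsq (n := 1)).differentiable one_ne_zero p).mul
    (by fun_prop) |>.sub (by fun_prop)) ?_
  have h1 : HasDerivAt (fun s : ℝ => p.2.1 j + s) 1 0 := by
    simpa using (hasDerivAt_id (0 : ℝ)).const_add (p.2.1 j)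
  have h := ((hasDerivAt_zsq_line p (0, Pi.single j 1, 0)).mul h1).sub_const (p.2.2 * p.1 j)
  convert! h using 1
  · ext s
    simp
  · simp [Pi.single_apply]
    ring

theorem fderiv_gaugeField_comp_t (p : Heis m) :
    fderiv ℝ (fun q : Heis m => 2 * q.2.2 * zsq q) p (0, 0, 1) = 2 * zsq p := by
  refine fderiv_apply_eq_of_line (DifferentiableAt.mul (by fun_prop)
    ((contDiff_zsq (n := 1)).differentiable one_ne_zero p)) ?_
  have h1 : HasDerivAt (fun s : ℝ => 2 * (p.2.2 + s)) 2 0 := by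
    simpa using ((hasDerivAt_id (0 : ℝ)).const_add (p.2.2)).const_mul 2
  have h := h1.mul (hasDerivAt_zsq_line p (0, 0, 1))
  convert! h using 1
  · ext s
    simp
  · simp

theorem fderiv_gaugeField_eq_sum (g : Heis m → ℝ) (p : Heis m) :
    fderiv ℝ g p (hlift p (gaugeGrad p)) =
      ∑ j, ((zsq p * p.1 j + p.2.2 * p.2.1 j) * fderiv ℝ g p (Pi.single j 1, 0, 0) +
        (zsq p * p.2.1 j - p.2.2 * p.1 j) * fderiv ℝ g p (0, Pi.single j 1, 0)) +
      2 * p.2.2 * zsq p * fderiv ℝ g p (0, 0, 1) := by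
  have : hlift p (gaugeGrad p) =
      ∑ j, ((zsq p * p.1 j + p.2.2 * p.2.1 j) • ((Pi.single j 1, 0, 0) : Heis m) +
        (zsq p * p.2.1 j - p.2.2 * p.1 j) • ((0, Pi.single j 1, 0) : Heis m)) +
      (2 * p.2.2 * zsq p) • ((0, 0, 1) : Heis m) := by
    rw [hlift_gaugeGrad]
    refine Prod.ext ?_ (Prod.ext ?_ ?_)
    · ext i
      simp [Prod.fst_sum, Finset.sum_apply, Pi.single_apply]
    · ext i
      simp [Prod.fst_sum, Prod.snd_sum, Finset.sum_apply, Pi.single_apply]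
    · simp [Prod.snd_sum]
  rw [this, map_add, map_sum]
  simp only [map_add, map_smul, smul_eq_mul]

theorem integral_sum_add_add {ι X : Type*} [Fintype ι] [MeasurableSpace X] {μ : Measure X}
    {a b : ι → X → ℝ} {c : X → ℝ} (ha : ∀ i, Integrable (a i) μ) (hb : ∀ i, Integrable (b i) μ)
    (hc : Integrable c μ) : ∫ x, (∑ i, (a i x + b i x)) + c x ∂μ =
      ∑ i, (∫ x, a i x ∂μ + ∫ x, b i x ∂μ) + ∫ x, c x ∂μ := by
  have hab : ∀ i, Integrable (fun x => a i x + b i x) μ := fun i => (ha i).add (hb i)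
  rw [integral_add (integrable_finsetSum _ fun i _ => hab i) hc,
    integral_finsetSum _ fun i _ => hab i]
  simp only [fun i => integral_add (ha i) (hb i)]

/-- The divergence theorem for the vector field `gaugeGrad`. -/
theorem integral_fderiv_gaugeField {g : Heis m → ℝ} (hg : ContDiff ℝ 1 g)
    (hc : HasCompactSupport g) :
    ∫ p, fderiv ℝ g p (hlift p (gaugeGrad p)) = -∫ p, (2 * m + 4) * zsq p * g p := by
  have hx : ∀ j : Fin m, ContDiff ℝ 1 fun q : Heis m => zsq q * q.1 j + q.2.2 * q.2.1 j := fun j =>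
    (contDiff_zsq.mul (by fun_prop)).add (by fun_prop)
  have hy : ∀ j : Fin m, ContDiff ℝ 1 fun q : Heis m => zsq q * q.2.1 j - q.2.2 * q.1 j := fun j =>
    (contDiff_zsq.mul (by fun_prop)).sub (by fun_prop)
  have ht : ContDiff ℝ 1 fun q : Heis m => 2 * q.2.2 * zsq q :=
    ContDiff.mul (by fun_prop) contDiff_zsq
  have Ix := fun j => integral_mul_fderiv hg hc (hx j) (Pi.single j 1, 0, 0)
  have Iy := fun j => integral_mul_fderiv hg hc (hy j) (0, Pi.single j 1, 0)
  have It := integral_mul_fderiv hg hc ht (0, 0, 1)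
  simp only [fderiv_gaugeField_comp_x] at Ix
  simp only [fderiv_gaugeField_comp_y] at Iy
  simp only [fderiv_gaugeField_comp_t] at It
  simp only [fderiv_gaugeField_eq_sum]
  rw [integral_sum_add_add (fun j => (Ix j).1) (fun j => (Iy j).1) It.1]
  simp only [(Ix _).2.2, (Iy _).2.2, It.2.2, ← neg_add, Finset.sum_neg_distrib]
  rw [← integral_sum_add_add (fun j => (Ix j).2.1) (fun j => (Iy j).2.1) It.2.1]
  congr 1
  refine integral_congr_ae (Eventually.of_forall fun p => ?_)
  have : ∀ j, (2 * p.1 j ^ 2 + zsq p) * g p + (2 * p.2.1 j ^ 2 + zsq p) * g p =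
    2 * g p * (p.1 j ^ 2 + p.2.1 j ^ 2) + 2 * zsq p * g p := fun j => by ring
  simp only [this, Finset.sum_add_distrib, ← Finset.mul_sum, Finset.sum_const, Finset.card_univ,
    Fintype.card_fin, nsmul_eq_mul]
  have hz : zsq p = ∑ i, p.1 i ^ 2 + ∑ i, p.2.1 i ^ 2 := Finset.sum_add_distrib
  rw [← hz]
  ring

/-! ### Radial supersolutions -/

/-- The coefficient `|∇v|⁻¹ φ(|∇v|) α'(r) r⁻³` of `gaugeGrad` in the flux of `v = α(r)`,
where `β = α'`. -/
def radialCoeff (φ β : ℝ → ℝ) (p : Heis m) : ℝ :=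
  φ (√(zsq p) / gauge p * β (gauge p)) / (√(zsq p) * gauge p ^ 2)

/-- The divergence of the flux of a radial function. -/
def radialDiv (φ β : ℝ → ℝ) (p : Heis m) : ℝ :=
  fderiv ℝ (radialCoeff φ β) p (hlift p (gaugeGrad p)) + (2 * m + 4) * zsq p * radialCoeff φ β p

section

variable {φ β : ℝ → ℝ} {p : Heis m}

theorem gauge_pos_of_zsq_pos (hz : 0 < zsq p) : 0 < gauge p :=
  (gauge_nonneg p).lt_of_ne' fun h => by
    have := hz.trans_le (zsq_le_gauge_sq p)
    simp [h] at this

theorem contDiffAt_radialCoeff (hφ : CondPhi φ) (hz : 0 < zsq p)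
    (hβ : ContDiffAt ℝ 1 β (gauge p)) (hβ0 : 0 < β (gauge p)) :
    ContDiffAt ℝ 1 (radialCoeff φ β) p := by
  have hr := gauge_pos_of_zsq_pos hz
  have hs : 0 < √(zsq p) := Real.sqrt_pos.2 hz
  have hg : ContDiffAt ℝ 1 (gauge : Heis m → ℝ) p := contDiffAt_gauge hr
  have hS : ContDiffAt ℝ 1 (fun q : Heis m => √(zsq q)) p := contDiff_zsq.contDiffAt.sqrt hz.ne'
  have hP : 0 < √(zsq p) / gauge p * β (gauge p) := by positivity
  have hφ' : ContDiffAt ℝ 1 φ (√(zsq p) / gauge p * β (gauge p)) :=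
    hφ.contDiffOn.contDiffAt (Ioi_mem_nhds hP)
  refine ContDiffAt.div ?_ (hS.mul (hg.pow 2)) (by positivity)
  exact ContDiffAt.comp p (g := φ) hφ' ((hS.div hg hr.ne').mul (hβ.comp p hg))

theorem hasDerivAt_sqrt_zsq_gaugeField (hz : 0 < zsq p) :
    HasDerivAt (fun s : ℝ => √(zsq (p + s • hlift p (gaugeGrad p)))) (√(zsq p) ^ 3) 0 := by
  have hs : 0 < √(zsq p) := Real.sqrt_pos.2 hz
  convert! (hasDerivAt_zsq_gaugeField p).sqrt (by simpa using hz.ne') using 1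
  rw [zero_smul, add_zero]
  have := Real.sq_sqrt hz.le
  rw [eq_div_iff (by positivity)]
  nth_rw 3 [← this]
  ring

theorem hasDerivAt_gauge_gaugeField (hr : 0 < gauge p) :
    HasDerivAt (fun s : ℝ => gauge (p + s • hlift p (gaugeGrad p))) (√(zsq p) ^ 2 * gauge p) 0 := by
  have hN := gaugePow_pos hr
  have h1 := (hasDerivAt_gaugePow_gaugeField p).sqrt (by simpa using hN.ne')
  convert! h1.sqrt (by simpa using (Real.sqrt_pos.2 hN).ne') using 1
  rw [zero_smul, add_zero, ← gauge_sq, Real.sqrt_sq hr.le, ← gauge_pow_four,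
    Real.sq_sqrt (zsq_nonneg p)]
  field_simp
  norm_num

/-- The quotient and chain rules with `|z|`, `r` and `β(r)` replaced by arbitrary functions along a
line. -/
theorem hasDerivAt_flux_coeff {S R b : ℝ → ℝ} {S' R' b' φ' x : ℝ} (hS : HasDerivAt S S' x)
    (hR : HasDerivAt R R' x) (hb : HasDerivAt b b' x) (hS0 : 0 < S x) (hR0 : 0 < R x)
    (hφ : HasDerivAt φ φ' (S x / R x * b x)) :
    HasDerivAt (fun s => φ (S s / R s * b s) / (S s * R s ^ 2))
      ((φ' * ((S' * R x - S x * R') / R x ^ 2 * b x + S x / R x * b') * (S x * R x ^ 2) -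
        φ (S x / R x * b x) * (S' * R x ^ 2 + S x * (2 * R x * R'))) / (S x * R x ^ 2) ^ 2) x := by
  have hnum : HasDerivAt (fun s => φ (S s / R s * b s)) _ x :=
    HasDerivAt.comp x (h₂ := φ) hφ ((hS.div hR hR0.ne').mul hb)
  have hden : HasDerivAt (fun s => S s * R s ^ 2) _ x := hS.mul (hR.pow 2)
  convert! hnum.div hden (by positivity) using 1
  simp

/-- Along `gaugeGrad`, `|z|` and `r` have the same logarithmic derivative `|z|²`, so `|z| / r` is
stationary and `φ'` multiplies only `β'`. The denominator `|z| r²` contributes `-3|z|²`, which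
together with the divergence `(2m+4)|z|²` of the field leaves `2m+1`, the homogeneous dimension
minus one. -/
theorem radialDiv_eq (hφ : CondPhi φ) (hz : 0 < zsq p)
    (hβ : ContDiffAt ℝ 1 β (gauge p)) (hβ0 : 0 < β (gauge p)) :
    radialDiv φ β p = (√(zsq p) / gauge p) ^ 2 *
        deriv φ (√(zsq p) / gauge p * β (gauge p)) * deriv β (gauge p) +
      (2 * m + 1) / gauge p *
        (√(zsq p) / gauge p * φ (√(zsq p) / gauge p * β (gauge p))) := by
  have hr := gauge_pos_of_zsq_pos hz
  have hs : 0 < √(zsq p) := Real.sqrt_pos.2 hz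
  have hP : 0 < √(zsq p) / gauge p * β (gauge p) := by positivity
  have hφ' : HasDerivAt φ (deriv φ (√(zsq p) / gauge p * β (gauge p)))
      (√(zsq p) / gauge p * β (gauge p)) :=
    ((hφ.contDiffOn.contDiffAt (Ioi_mem_nhds hP)).differentiableAt one_ne_zero).hasDerivAt
  have hβ' : HasDerivAt β (deriv β (gauge p)) (gauge p) :=
    (hβ.differentiableAt one_ne_zero).hasDerivAt
  have hS := hasDerivAt_sqrt_zsq_gaugeField hz
  have hR := hasDerivAt_gauge_gaugeField hr
  have h0 : p + (0 : ℝ) • hlift p (gaugeGrad p) = p := by rw [zero_smul, add_zero]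
  have hb : HasDerivAt (fun s : ℝ => β (gauge (p + s • hlift p (gaugeGrad p))))
      (deriv β (gauge p) * (√(zsq p) ^ 2 * gauge p)) 0 :=
    HasDerivAt.comp (0 : ℝ) (by rw [h0]; exact hβ') hR
  have h := hasDerivAt_flux_coeff hS hR hb (by rw [h0]; exact hs) (by rw [h0]; exact hr)
    (by rw [h0]; exact hφ')
  rw [h0] at h
  rw [radialDiv, fderiv_apply_eq_of_line
    ((contDiffAt_radialCoeff hφ hz hβ hβ0).differentiableAt one_ne_zero) h, radialCoeff]
  have hzz : zsq p = √(zsq p) ^ 2 := (Real.sq_sqrt hz.le).symm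
  clear h hb hR hS hφ' hP hβ'
  generalize √(zsq p) = S at *
  rw [hzz]
  generalize φ (S / gauge p * β (gauge p)) = x
  generalize deriv φ (S / gauge p * β (gauge p)) = y
  field_simp
  ring

end

/-- Integrated form of `(Φ2)`. -/
theorem CondPhi2.map_mul_le {φ : ℝ → ℝ} {D τ : ℝ} (h2 : CondPhi2 φ D τ) (hφ : CondPhi φ) {s t : ℝ}
    (hs : s ∈ Ioc (0 : ℝ) 1) (ht : 0 ≤ t) : φ (s * t) ≤ D * s ^ τ * φ t := by
  have hd : ∀ t, 0 < t → HasDerivAt φ (deriv φ t) t := fun t ht =>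
    ((hφ.contDiffOn.contDiffAt (Ioi_mem_nhds ht)).differentiableAt one_ne_zero).hasDerivAt
  have hder : ∀ t, 0 < t → HasDerivAt (fun t => D * s ^ τ * φ t - φ (s * t))
      (D * s ^ τ * deriv φ t - s * deriv φ (s * t)) t := by
    intro t ht
    have h1 : HasDerivAt (fun t => s * t) s t := by simpa using (hasDerivAt_id t).const_mul s
    have h2 := HasDerivAt.comp t (hd (s * t) (mul_pos hs.1 ht)) h1
    convert! ((hd t ht).const_mul (D * s ^ τ)).sub h2 using 1
    ring
  have hmono : MonotoneOn (fun t => D * s ^ τ * φ t - φ (s * t)) (Ici 0) := by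
    refine monotoneOn_of_deriv_nonneg (convex_Ici 0) ?_ ?_ ?_
    · refine (continuousOn_const.mul hφ.continuousOn).sub
        (hφ.continuousOn.comp (by fun_prop) fun t ht => mul_nonneg hs.1.le ht)
    · intro t ht
      rw [interior_Ici] at ht
      exact (hder t ht).differentiableAt.differentiableWithinAt
    · intro t ht
      rw [interior_Ici] at ht
      rw [(hder t ht).deriv]
      exact sub_nonneg.2 (h2 s hs t ht)
  have := hmono self_mem_Ici ht ht
  simp only [mul_zero, hφ.map_zero, sub_zero] at this
  linarith

/-- A radial function built from a solution of the one-dimensional inequality is a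
supersolution off the axis `z = 0`. -/
theorem radialDiv_le {φ l β : ℝ → ℝ} {D Λ τ a : ℝ} {p : Heis m} (hφ : CondPhi φ)
    (hφ2 : CondPhi2 φ D τ) (hl2 : CondL2 l Λ τ) (hD : 0 < D) (hΛ : 0 < Λ) (ha : 0 ≤ a)
    (hz : 0 < zsq p) (hβ : ContDiffAt ℝ 1 β (gauge p)) (hβ0 : 0 < β (gauge p))
    (hβ1 : 0 ≤ deriv β (gauge p))
    (hode : deriv φ (β (gauge p)) * deriv β (gauge p) +
      (2 * m + 1) / gauge p * φ (β (gauge p)) ≤ 1 / (2 * D * Λ) * a * l (β (gauge p))) :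
    radialDiv φ β p ≤ a * l (√(zsq p) / gauge p * β (gauge p)) / 2 := by
  have hr := gauge_pos_of_zsq_pos hz
  have hs0 : 0 < √(zsq p) := Real.sqrt_pos.2 hz
  rw [radialDiv_eq hφ hz hβ hβ0]
  set s := √(zsq p) / gauge p with hs
  have hspos : 0 < s := by positivity
  have hs1 : s ≤ 1 := by
    rw [hs, div_le_one hr]
    exact Real.sqrt_le_iff.2 ⟨hr.le, zsq_le_gauge_sq p⟩
  set b := β (gauge p)
  have e1 := hφ2 s ⟨hspos, hs1⟩ b hβ0
  have e2 := hφ2.map_mul_le hφ ⟨hspos, hs1⟩ hβ0.le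
  have e3 := hl2 s ⟨hspos.le, hs1⟩ b hβ0.le
  rw [Real.rpow_add hspos, Real.rpow_one] at e3
  set σ := s ^ τ
  have hσ : 0 < σ := Real.rpow_pos_of_pos hspos τ
  -- Here `s = |∇r|`. Both terms on the left acquire the common factor `D s^(1+τ)`, so the
  -- one-dimensional inequality applies, and (L2) then absorbs `s^(1+τ)` into `l(s b)`.
  have t1 : s ^ 2 * deriv φ (s * b) * deriv β (gauge p) ≤
      D * (s * σ) * (deriv φ b * deriv β (gauge p)) := by
    have := mul_le_mul_of_nonneg_left e1 (mul_nonneg hspos.le hβ1)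
    linarith
  have t2 : (2 * m + 1) / gauge p * (s * φ (s * b)) ≤
      D * (s * σ) * ((2 * m + 1) / gauge p * φ b) := by
    have hc : 0 ≤ (2 * (m : ℝ) + 1) / gauge p * s := by positivity
    have := mul_le_mul_of_nonneg_left e2 hc
    linarith
  have t3 := mul_le_mul_of_nonneg_left hode (by positivity : 0 ≤ D * (s * σ))
  have t4 : D * (s * σ) * (1 / (2 * D * Λ) * a * l b) = a / (2 * Λ) * (s * σ * l b) := by
    field_simp
  have t5 := mul_le_mul_of_nonneg_left e3 (by positivity : 0 ≤ a / (2 * Λ))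
  have t6 : a / (2 * Λ) * (Λ * l (s * b)) = a * l (s * b) / 2 := by
    field_simp
  linarith

/-! ### The functions `K`, `K⁻¹` and `F` -/

section OneDim

variable {φ f l : ℝ → ℝ}

theorem CondPhi.continuousOn_deriv (hφ : CondPhi φ) : ContinuousOn (deriv φ) (Ioi 0) :=
  hφ.contDiffOn.continuousOn_deriv_of_isOpen isOpen_Ioi le_rfl

theorem continuousOn_integrandK (hφ : CondPhi φ) (hl : CondL l) :
    ContinuousOn (fun s => s * deriv φ s / l s) (Ioi 0) :=
  (continuousOn_id.mul hφ.continuousOn_deriv).div (hl.continuousOn.mono Ioi_subset_Ici_self)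
    fun s hs => (hl.pos s hs).ne'

theorem integrandK_pos (hφ : CondPhi φ) (hl : CondL l) {t : ℝ} (ht : 0 < t) :
    0 < t * deriv φ t / l t :=
  div_pos (mul_pos ht (hφ.deriv_pos t ht)) (hl.pos t ht)

theorem intervalIntegrable_integrandK (hφ : CondPhi φ) (hl : CondL l) (h : CondPhiL φ l) {t : ℝ}
    (ht : 0 ≤ t) : IntervalIntegrable (fun s => s * deriv φ s / l s) volume 0 t := by
  obtain ⟨S, hS, hSi⟩ := h.integrable_zero
  obtain ⟨δ, hδ, hsub⟩ := mem_nhdsGT_iff_exists_Ioc_subset.1 hS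
  have h1 : IntervalIntegrable (fun s => s * deriv φ s / l s) volume 0 δ :=
    (intervalIntegrable_iff_integrableOn_Ioc_of_le (le_of_lt hδ)).2 (hSi.mono_set hsub)
  rcases ht.eq_or_lt with rfl | ht
  · exact IntervalIntegrable.refl
  · refine h1.trans (ContinuousOn.intervalIntegrable
      ((continuousOn_integrandK hφ hl).mono fun x hx => ?_))
    exact lt_of_lt_of_le (lt_min hδ ht) hx.1

theorem hasDerivAt_funK (hφ : CondPhi φ) (hl : CondL l) (h : CondPhiL φ l) {t : ℝ} (ht : 0 < t) :
    HasDerivAt (funK φ l) (t * deriv φ t / l t) t :=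
  intervalIntegral.integral_hasDerivAt_right (intervalIntegrable_integrandK hφ hl h ht.le)
    ((continuousOn_integrandK hφ hl).stronglyMeasurableAtFilter isOpen_Ioi t ht)
    ((continuousOn_integrandK hφ hl).continuousAt (Ioi_mem_nhds ht))

theorem strictMonoOn_funK (hφ : CondPhi φ) (hl : CondL l) (h : CondPhiL φ l) :
    StrictMonoOn (funK φ l) (Ici 0) := by
  intro a ha b hb hab
  have hI := fun t ht => intervalIntegrable_integrandK hφ hl h (t := t) ht
  have := intervalIntegral.intervalIntegral_pos_of_pos_on ((hI a ha).symm.trans (hI b hb))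
    (fun x hx => integrandK_pos hφ hl (lt_of_le_of_lt ha hx.1)) hab
  rw [← intervalIntegral.integral_interval_sub_left (hI b hb) (hI a ha)] at this
  exact sub_pos.1 this

theorem funK_zero : funK φ l 0 = 0 := intervalIntegral.integral_same

theorem funK_pos (hφ : CondPhi φ) (hl : CondL l) (h : CondPhiL φ l) {t : ℝ} (ht : 0 < t) :
    0 < funK φ l t :=
  funK_zero (φ := φ) (l := l) ▸ strictMonoOn_funK hφ hl h self_mem_Ici ht.le ht

theorem funK_invK (hφ : CondPhi φ) (hl : CondL l) (h : CondPhiL φ l) {y : ℝ} (hy : 0 ≤ y) :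
    funK φ l (invK φ l y) = y :=
  (funK_bijOn hφ hl h).invOn_invFunOn.2 hy

theorem invK_nonneg (hφ : CondPhi φ) (hl : CondL l) (h : CondPhiL φ l) {y : ℝ} (hy : 0 ≤ y) :
    0 ≤ invK φ l y :=
  (funK_bijOn hφ hl h).surjOn.mapsTo_invFunOn hy

theorem invK_lt_iff (hφ : CondPhi φ) (hl : CondL l) (h : CondPhiL φ l) {y t : ℝ} (hy : 0 ≤ y)
    (ht : 0 ≤ t) : invK φ l y < t ↔ y < funK φ l t := by
  rw [← (strictMonoOn_funK hφ hl h).lt_iff_lt (invK_nonneg hφ hl h hy) ht, funK_invK hφ hl h hy]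

theorem strictMonoOn_invK (hφ : CondPhi φ) (hl : CondL l) (h : CondPhiL φ l) :
    StrictMonoOn (invK φ l) (Ici 0) := by
  intro a ha b hb hab
  rw [invK_lt_iff hφ hl h ha (invK_nonneg hφ hl h hb), funK_invK hφ hl h hb]
  exact hab

theorem invK_pos (hφ : CondPhi φ) (hl : CondL l) (h : CondPhiL φ l) {y : ℝ} (hy : 0 < y) :
    0 < invK φ l y :=
  (invK_nonneg hφ hl h le_rfl).trans_lt (strictMonoOn_invK hφ hl h self_mem_Ici hy.le hy)

theorem hasDerivAt_invK (hφ : CondPhi φ) (hl : CondL l) (h : CondPhiL φ l) {y : ℝ} (hy : 0 < y) :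
    HasDerivAt (invK φ l) (invK φ l y * deriv φ (invK φ l y) / l (invK φ l y))⁻¹ y := by
  have hpos := invK_pos hφ hl h hy
  refine HasDerivAt.of_local_left_inverse ?_ (hasDerivAt_funK hφ hl h hpos)
    (integrandK_pos hφ hl hpos).ne'
    (mem_of_superset (Ioi_mem_nhds hy) fun z (hz : 0 < z) => funK_invK hφ hl h hz.le)
  refine StrictMonoOn.continuousAt_of_image_mem_nhds
    ((strictMonoOn_invK hφ hl h).mono Ioi_subset_Ici_self) (Ioi_mem_nhds hy)
    (mem_of_superset (Ioi_mem_nhds hpos) fun t (ht : 0 < t) => ⟨funK φ l t, ?_, ?_⟩)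
  · exact funK_pos hφ hl h ht
  · exact (funK_bijOn hφ hl h).invOn_invFunOn.1 ht.le

/-! ### The primitive `F` and the speed `K⁻¹(σ F)` -/

theorem CondF.intervalIntegrable (hf : CondF f) {a b : ℝ} (ha : 0 ≤ a) (hb : 0 ≤ b) :
    IntervalIntegrable f volume a b :=
  (hf.continuousOn.mono fun _ hx => (le_min ha hb).trans hx.1).intervalIntegrable

theorem hasDerivAt_primF (hf : CondF f) {t : ℝ} (ht : 0 < t) : HasDerivAt (primF f) (f t) t :=
  intervalIntegral.integral_hasDerivAt_right (hf.intervalIntegrable le_rfl ht.le)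
    ((hf.continuousOn.mono Ioi_subset_Ici_self).stronglyMeasurableAtFilter isOpen_Ioi t ht)
    (hf.continuousOn.continuousAt (Ici_mem_nhds ht))

theorem primF_pos (hf : CondF f) {t : ℝ} (ht : 0 < t) : 0 < primF f t :=
  intervalIntegral.intervalIntegral_pos_of_pos_on (hf.intervalIntegrable le_rfl ht.le)
    (fun _ hx => hf.pos _ hx.1) ht

theorem strictMonoOn_primF (hf : CondF f) : StrictMonoOn (primF f) (Ioi 0) := by
  refine strictMonoOn_of_deriv_pos (convex_Ioi 0)
    (fun t ht => (hasDerivAt_primF hf ht).continuousAt.continuousWithinAt) fun t ht => ?_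
  rw [interior_Ioi] at ht
  rw [(hasDerivAt_primF hf ht).deriv]
  exact hf.pos t ht

/-- Convexity of `F` together with `F(0) = 0`. It turns a factor in front of `F` into a rescaling of
its argument. -/
theorem primF_mul_le (hf : CondF f) {s t : ℝ} (hs : s ∈ Ioc (0 : ℝ) 1) (ht : 0 ≤ t) :
    primF f (s * t) ≤ s * primF f t := by
  have h1 : s * ∫ x in (0 : ℝ)..t, f (s * x) = primF f (s * t) := by
    rw [intervalIntegral.mul_integral_comp_mul_left, mul_zero, primF]
  rw [← h1]
  refine mul_le_mul_of_nonneg_left ?_ hs.1.le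
  refine intervalIntegral.integral_mono_on ht ?_ (hf.intervalIntegrable le_rfl ht) fun x hx => ?_
  · refine ContinuousOn.intervalIntegrable (hf.continuousOn.comp (by fun_prop) fun x hx => ?_)
    rw [uIcc_of_le ht] at hx
    exact mul_nonneg hs.1.le hx.1
  · exact hf.monotoneOn (mul_nonneg hs.1.le hx.1) hx.1 (mul_le_of_le_one_left hx.1 hs.2)

theorem invK_mul_primF_pos (hφ : CondPhi φ) (hf : CondF f) (hl : CondL l) (h : CondPhiL φ l)
    {σ a : ℝ} (hσ : 0 < σ) (ha : 0 < a) : 0 < invK φ l (σ * primF f a) :=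
  invK_pos hφ hl h (mul_pos hσ (primF_pos hf ha))

theorem hasDerivAt_invK_mul_primF (hφ : CondPhi φ) (hf : CondF f) (hl : CondL l)
    (h : CondPhiL φ l) {σ a : ℝ} (hσ : 0 < σ) (ha : 0 < a) :
    HasDerivAt (fun a => invK φ l (σ * primF f a))
      ((invK φ l (σ * primF f a) * deriv φ (invK φ l (σ * primF f a)) /
        l (invK φ l (σ * primF f a)))⁻¹ * (σ * f a)) a :=
  HasDerivAt.comp a (hasDerivAt_invK hφ hl h (mul_pos hσ (primF_pos hf ha)))
    ((hasDerivAt_primF hf ha).const_mul σ)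

theorem strictMonoOn_invK_mul_primF (hφ : CondPhi φ) (hf : CondF f) (hl : CondL l)
    (h : CondPhiL φ l) {σ : ℝ} (hσ : 0 < σ) :
    StrictMonoOn (fun a => invK φ l (σ * primF f a)) (Ioi 0) := fun _ ha _ hb hab =>
  strictMonoOn_invK hφ hl h (mul_pos hσ (primF_pos hf ha)).le (mul_pos hσ (primF_pos hf hb)).le
    (mul_lt_mul_of_pos_left (strictMonoOn_primF hf ha hb hab) hσ)

/-- The Keller-Osserman condition is invariant under multiplication of `F` by small constants. -/
theorem KellerOsserman.integrableOn (hφ : CondPhi φ) (hf : CondF f) (hl : CondL l)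
    (h : CondPhiL φ l) (hKO : KellerOsserman φ f l) {σ : ℝ} (hσ : σ ∈ Ioc (0 : ℝ) 1) :
    ∃ a, 0 < a ∧ IntegrableOn (fun t => (invK φ l (σ * primF f t))⁻¹) (Ioi a) := by
  obtain ⟨S, hS, hSi⟩ := hKO
  obtain ⟨a, ha⟩ := mem_atTop_sets.1 hS
  -- Since `σ F(t) ≥ F(σ t)`, the integrand is dominated by `1 / K⁻¹(F(σ t))`. The substitution `t ↦
  -- σ t` accounts for the division by `σ`; the `1` keeps the endpoint positive.
  refine ⟨max a 1 / σ, div_pos (by positivity) hσ.1, ?_⟩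
  have h1 : IntegrableOn (fun t => (invK φ l (primF f t))⁻¹) (Ioi (max a 1)) := by
    simp only [one_div] at hSi
    exact hSi.mono_set fun t ht => ha t ((le_max_left a 1).trans (le_of_lt ht))
  have h2 : IntegrableOn (fun t => (invK φ l (primF f (σ * t)))⁻¹) (Ioi (max a 1 / σ)) := by
    rw [integrableOn_Ioi_comp_mul_left_iff (fun t => (invK φ l (primF f t))⁻¹) _ hσ.1,
      mul_div_cancel₀ _ hσ.1.ne']
    exact h1
  have hpos : ∀ t ∈ Ioi (max a 1 / σ), 0 < t := fun t ht =>
    (div_pos (by positivity) hσ.1).trans ht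
  refine h2.mono' ?_ ?_
  · refine ContinuousOn.aestronglyMeasurable (fun t ht => ?_) measurableSet_Ioi
    exact ((hasDerivAt_invK_mul_primF hφ hf hl h hσ.1 (hpos t ht)).continuousAt.inv₀
      (invK_mul_primF_pos hφ hf hl h hσ.1 (hpos t ht)).ne').continuousWithinAt
  · refine (ae_restrict_mem measurableSet_Ioi).mono fun t ht => ?_
    have ht := hpos t ht
    have p1 := invK_mul_primF_pos hφ hf hl h hσ.1 ht
    have p2 := primF_pos hf (mul_pos hσ.1 ht)
    rw [Real.norm_of_nonneg (by positivity)]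
    refine inv_anti₀ (invK_pos hφ hl h p2) ?_
    exact (strictMonoOn_invK hφ hl h).monotoneOn p2.le (mul_pos hσ.1 (primF_pos hf ht)).le
      (primF_mul_le hf hσ ht.le)

end OneDim

/-! ### Blow-up solutions of `α' = κ(α)` -/

/-- If `1/κ` is integrable at infinity, then the solution of `α' = κ(α)`, `α(r₀) = ε`, blows up
in finite time. -/
theorem exists_blowup_solution {κ : ℝ → ℝ} (hc : ContinuousOn κ (Ioi 0))
    (hpos : ∀ a, 0 < a → 0 < κ a) (hmono : MonotoneOn κ (Ioi 0)) {a₀ : ℝ} (ha₀ : 0 < a₀)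
    (hint : IntegrableOn (fun t => (κ t)⁻¹) (Ioi a₀)) {ε : ℝ} (hε : 0 < ε) (r₀ : ℝ) :
    ∃ (T : ℝ) (α : ℝ → ℝ), (∀ r ∈ Ico r₀ T, ε ≤ α r ∧ HasDerivAt α (κ (α r)) r) ∧ α r₀ = ε ∧
      Tendsto α (𝓝[<] T) atTop ∧
      ∀ η r₁, ε < η → r₀ < r₁ → κ η * (r₁ - r₀) ≤ η - ε → r₁ < T ∧ α r₁ ≤ η := by
  have hinv : ContinuousOn (fun t => (κ t)⁻¹) (Ioi 0) := hc.inv₀ fun a ha => (hpos a ha).ne'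
  have hii : ∀ a b, 0 < a → 0 < b → IntervalIntegrable (fun t => (κ t)⁻¹) volume a b :=
    fun a b ha hb => (hinv.mono fun x hx => lt_of_lt_of_le (lt_min ha hb) hx.1).intervalIntegrable
  have hIoi : IntegrableOn (fun t => (κ t)⁻¹) (Ioi ε) := by
    have h1 := (intervalIntegrable_iff.1 (hii ε a₀ hε ha₀))
    refine (h1.union hint).mono_set fun x (hx : ε < x) => ?_
    rcases le_or_gt x a₀ with h | h
    · exact Or.inl (by rw [uIoc_of_le (hx.le.trans h)]; exact ⟨hx, h⟩)
    · exact Or.inr h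
  -- Separation of variables: `τ a` is the radius at which the solution reaches the value `a`, and
  -- `α` is its inverse. Using all `a > 0`, including values below `ε`, gives a two-sided derivative
  -- at `r₀`.
  set τ : ℝ → ℝ := fun a => r₀ + ∫ t in ε..a, (κ t)⁻¹ with hτ
  have hτε : τ ε = r₀ := by simp [hτ]
  have hder : ∀ a, 0 < a → HasDerivAt τ (κ a)⁻¹ a := fun a ha =>
    (intervalIntegral.integral_hasDerivAt_right (hii ε a hε ha)
      (hinv.stronglyMeasurableAtFilter isOpen_Ioi a ha)
      (hinv.continuousAt (Ioi_mem_nhds ha))).const_add r₀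
  have hτc : ContinuousOn τ (Ioi 0) := fun a ha => (hder a ha).continuousAt.continuousWithinAt
  have hτm : StrictMonoOn τ (Ioi 0) := by
    refine strictMonoOn_of_deriv_pos (convex_Ioi 0) hτc fun a ha => ?_
    rw [interior_Ioi] at ha
    rw [(hder a ha).deriv]
    exact inv_pos.2 (hpos a ha)
  set T := r₀ + ∫ t in Ioi ε, (κ t)⁻¹ with hT
  have hlim : Tendsto τ atTop (𝓝 T) :=
    (intervalIntegral_tendsto_integral_Ioi ε hIoi tendsto_id).const_add r₀
  have hltT : ∀ a, 0 < a → τ a < T := by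
    intro a ha
    refine (hτm ha (ha.trans (lt_add_one a)) (lt_add_one a)).trans_le ?_
    refine ge_of_tendsto hlim ((eventually_ge_atTop (a + 1)).mono fun b hb => ?_)
    have h1 : (0 : ℝ) < a + 1 := by linarith
    exact hτm.monotoneOn h1 (h1.trans_le hb) hb
  set α := Function.invFunOn τ (Ioi 0) with hα
  have hατ : ∀ a, 0 < a → α (τ a) = a := fun a ha => hτm.injOn.leftInvOn_invFunOn ha
  have hsurj : ∀ r ∈ Ico r₀ T, ∃ a, ε ≤ a ∧ τ a = r := by
    intro r hr
    obtain ⟨b, hb1, hb2⟩ := ((hlim.eventually (lt_mem_nhds hr.2)).and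
      (eventually_ge_atTop ε)).exists
    obtain ⟨a, ha, har⟩ := intermediate_value_Icc hb2
      (hτc.mono fun x hx => hε.trans_le hx.1) ⟨hτε.symm ▸ hr.1, hb1.le⟩
    exact ⟨a, ha.1, har⟩
  have himage : ∀ a, 0 < a → τ '' Ioi 0 ∈ 𝓝 (τ a) := by
    intro a ha
    have h1 : 0 < a / 2 := by positivity
    have h2 : 0 < 2 * a := by positivity
    refine mem_of_superset (Icc_mem_nhds (hτm h1 ha (by linarith)) (hτm ha h2 (by linarith))) ?_
    intro r hr
    obtain ⟨b, hb, hbr⟩ := intermediate_value_Icc (by linarith : a / 2 ≤ 2 * a)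
      (hτc.mono fun x hx => h1.trans_le hx.1) hr
    exact ⟨b, h1.trans_le hb.1, hbr⟩
  have hαm : StrictMonoOn α (τ '' Ioi 0) := by
    rintro _ ⟨a, ha, rfl⟩ _ ⟨b, hb, rfl⟩ hab
    rw [hατ a ha, hατ b hb]
    exact (hτm.lt_iff_lt ha hb).1 hab
  have hαd : ∀ a, 0 < a → HasDerivAt α (κ a) (τ a) := by
    intro a ha
    have hcont : ContinuousAt α (τ a) := by
      refine hαm.continuousAt_of_image_mem_nhds (himage a ha) ?_
      rw [hατ a ha]
      refine mem_of_superset (Ioi_mem_nhds ha) fun b hb => ⟨τ b, ⟨b, hb, rfl⟩, hατ b hb⟩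
    have := HasDerivAt.of_local_left_inverse (f := τ) hcont (by rw [hατ a ha]; exact hder a ha)
      (inv_pos.2 (hpos a ha)).ne' ((eventually_mem_set.2 (himage a ha)).mono ?_)
    · rwa [inv_inv] at this
    · rintro _ ⟨b, hb, rfl⟩
      rw [hατ b hb]
  refine ⟨T, α, ?_, ?_, ?_, ?_⟩
  · intro r hr
    obtain ⟨a, ha, rfl⟩ := hsurj r hr
    have ha0 := hε.trans_le ha
    rw [hατ a ha0]
    exact ⟨ha, hαd a ha0⟩
  · rw [← hτε, hατ ε hε]
  · refine tendsto_atTop.2 fun M => ?_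
    have hM : 0 < max M ε := hε.trans_le (le_max_right _ _)
    filter_upwards [Ioo_mem_nhdsLT (hltT _ hM)] with r hr
    have h1 : r₀ ≤ τ (max M ε) := hτε ▸ hτm.monotoneOn hε hM (le_max_right _ _)
    obtain ⟨a, ha, rfl⟩ := hsurj r ⟨h1.trans hr.1.le, hr.2⟩
    rw [hατ a (hε.trans_le ha)]
    exact (le_max_left _ _).trans ((hτm.lt_iff_lt hM (hε.trans_le ha)).1 hr.1).le
  · intro η r₁ hη hr₁ hκ
    have hη0 := hε.trans hη
    have hle : r₁ ≤ τ η := by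
      -- Below the level `η` the speed is at most `κ η`, so climbing from `ε` to `η` takes at least
      -- `(η - ε) / κ η`.
      have h1 : (η - ε) * (κ η)⁻¹ ≤ ∫ t in ε..η, (κ t)⁻¹ := by
        rw [← smul_eq_mul, ← intervalIntegral.integral_const]
        refine intervalIntegral.integral_mono_on hη.le intervalIntegrable_const (hii ε η hε hη0)
          fun t ht => ?_
        exact inv_anti₀ (hpos t (hε.trans_le ht.1)) (hmono (hε.trans_le ht.1) hη0 ht.2)
      have h2 : r₁ - r₀ ≤ (η - ε) * (κ η)⁻¹ := by
        rw [← div_eq_mul_inv, le_div_iff₀ (hpos η hη0)]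
        linarith
      change r₁ ≤ r₀ + _
      linarith
    have hlt := hle.trans_lt (hltT η hη0)
    obtain ⟨a, ha, rfl⟩ := hsurj r₁ ⟨hr₁.le, hlt⟩
    refine ⟨hlt, ?_⟩
    rw [hατ a (hε.trans_le ha)]
    exact (hτm.le_iff_le (hε.trans_le ha) hη0).1 hle

/-- The one-dimensional barrier: a solution `α` of
`φ'(α') α'' + (c / r) φ(α') ≤ s f(α) l(α')` on `[r₀, T)` that blows up at `T` and stays below `η`
up to `r₁ < T`. -/
theorem exists_barrier {φ f l : ℝ → ℝ} (hφ : CondPhi φ) (hf : CondF f) (hl : CondL l)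
    (h : CondPhiL φ l) (hKO : KellerOsserman φ f l) {ε η r₀ r₁ s c : ℝ} (hε : 0 < ε) (hη : ε < η)
    (hr₀ : 0 < r₀) (hr₁ : r₀ < r₁) (hs : 0 < s) (hc : 0 ≤ c) :
    ∃ (T : ℝ) (α β : ℝ → ℝ), r₁ < T ∧ (∀ r ∈ Ico r₀ T, HasDerivAt α (β r) r ∧ 0 < β r ∧ ε ≤ α r) ∧
      ContDiffOn ℝ 1 β (Ioo r₀ T) ∧
      (∀ r ∈ Ioo r₀ T, 0 ≤ deriv β r ∧
        deriv φ (β r) * deriv β r + c / r * φ (β r) ≤ s * f (α r) * l (β r)) ∧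
      α r₀ = ε ∧ α r₁ ≤ η ∧ Tendsto α (𝓝[<] T) atTop := by
  have hη0 := hε.trans hη
  obtain ⟨C, hC1, hC⟩ := hl.cMonotone
  have hC0 : 0 < C := one_pos.trans_le hC1
  have hfε := hf.pos ε hε
  -- Chosen so that the initial value `φ(α'(r₀))` costs at most half of the budget `s f(α) l(α')`.
  -- The `+ 1` keeps the constant usable when `c = 0`.
  set δ := s * r₀ * f ε / (2 * (c * C + 1)) with hδ
  have hδ0 : 0 < δ := by positivity
  obtain ⟨t₀, ht₀, hsmall⟩ : ∃ t₀, 0 < t₀ ∧ ∀ t ∈ Ioo 0 t₀, φ t ≤ δ * l t := by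
    have := h.tendsto_zero.eventually (gt_mem_nhds hδ0)
    obtain ⟨t₀, ht₀, hsub⟩ := mem_nhdsGT_iff_exists_Ioo_subset.1 this
    refine ⟨t₀, ht₀, fun t ht => ?_⟩
    have h1 : φ t / l t < δ := hsub ht
    exact ((div_lt_iff₀ (hl.pos t ht.1)).1 h1).le
  set y := funK φ l (min t₀ ((η - ε) / (r₁ - r₀)))
  have hmin : 0 < min t₀ ((η - ε) / (r₁ - r₀)) :=
    lt_min ht₀ (div_pos (sub_pos.2 hη) (sub_pos.2 hr₁))
  have hy : 0 < y := funK_pos hφ hl h hmin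
  have hFη := primF_pos hf hη0
  -- Three demands on `σ`: at most `1` for the rescaled Keller–Osserman condition; `K⁻¹(σ F(η))`
  -- below both `t₀` and the mean slope `(η - ε) / (r₁ - r₀)`; and the second-order and friction
  -- terms within the other half of the budget.
  obtain ⟨σ, hσ0, hσ1, hσ2, hσ3⟩ : ∃ σ, 0 < σ ∧ σ ≤ 1 ∧ σ * primF f η < y ∧
      σ * (1 + c * C) ≤ s / 2 := by
    refine ⟨min 1 (min (y / (2 * primF f η)) (s / (2 * (1 + c * C)))), by positivity,
      min_le_left _ _, ?_, ?_⟩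
    · have : min 1 (min (y / (2 * primF f η)) (s / (2 * (1 + c * C)))) ≤ y / (2 * primF f η) :=
        (min_le_right _ _).trans (min_le_left _ _)
      have h2 := mul_le_mul_of_nonneg_right this hFη.le
      have h3 : y / (2 * primF f η) * primF f η = y / 2 := by field_simp
      linarith
    · have : min 1 (min (y / (2 * primF f η)) (s / (2 * (1 + c * C)))) ≤
        s / (2 * (1 + c * C)) := (min_le_right _ _).trans (min_le_right _ _)
      have h2 := mul_le_mul_of_nonneg_right this (by positivity : 0 ≤ 1 + c * C)
      have h3 : s / (2 * (1 + c * C)) * (1 + c * C) = s / 2 := by field_simp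
      linarith
  set κ : ℝ → ℝ := fun a => invK φ l (σ * primF f a) with hκ
  have hκd := fun a (ha : 0 < a) => hasDerivAt_invK_mul_primF hφ hf hl h hσ0 ha
  have hκpos : ∀ a, 0 < a → 0 < κ a := fun a ha => invK_mul_primF_pos hφ hf hl h hσ0 ha
  have hκmono : StrictMonoOn κ (Ioi 0) := strictMonoOn_invK_mul_primF hφ hf hl h hσ0
  have hκη : κ η < min t₀ ((η - ε) / (r₁ - r₀)) :=
    (invK_lt_iff hφ hl h (by positivity) hmin.le).2 hσ2
  obtain ⟨a₀, ha₀, hint⟩ := hKO.integrableOn hφ hf hl h ⟨hσ0, hσ1⟩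
  obtain ⟨T, α, hα, hαε, hlim, hη'⟩ := exists_blowup_solution (κ := κ)
    (fun a ha => (hκd a ha).continuousAt.continuousWithinAt) hκpos hκmono.monotoneOn ha₀ hint
    hε r₀
  have hT := hη' η r₁ hη hr₁ (by
    have := hκη.le.trans (min_le_right _ _)
    rwa [le_div_iff₀ (sub_pos.2 hr₁)] at this)
  set β : ℝ → ℝ := fun r => κ (α r) with hβ
  have hα0 : ∀ r ∈ Ico r₀ T, 0 < α r := fun r hr => hε.trans_le (hα r hr).1
  have hβ0 : ∀ r ∈ Ico r₀ T, 0 < β r := fun r hr => hκpos _ (hα0 r hr)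
  have hβd : ∀ r ∈ Ico r₀ T, HasDerivAt β (σ * f (α r) * l (β r) / deriv φ (β r)) r := by
    intro r hr
    have h1 := HasDerivAt.comp r (hκd _ (hα0 r hr)) (hα r hr).2
    convert! h1 using 1
    have p1 := hβ0 r hr
    have p2 := hφ.deriv_pos _ p1
    have p3 := hl.pos _ p1
    change _ = (β r * deriv φ (β r) / l (β r))⁻¹ * (σ * f (α r)) * β r
    field_simp
  have hφd : ∀ t, 0 < t → HasDerivAt φ (deriv φ t) t := fun t ht =>
    ((hφ.contDiffOn.contDiffAt (Ioi_mem_nhds ht)).differentiableAt one_ne_zero).hasDerivAt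
  have hφβ : ∀ r ∈ Ico r₀ T, HasDerivAt (fun r => φ (β r)) (σ * f (α r) * l (β r)) r := by
    intro r hr
    have h1 := HasDerivAt.comp r (hφd _ (hβ0 r hr)) (hβd r hr)
    convert! h1 using 1
    have p2 := hφ.deriv_pos _ (hβ0 r hr)
    field_simp
  have hαmono : MonotoneOn α (Ico r₀ T) := by
    refine monotoneOn_of_deriv_nonneg (convex_Ico r₀ T)
      (fun r hr => (hα r hr).2.continuousAt.continuousWithinAt) (fun r hr => ?_) fun r hr => ?_
    · exact (hα r (interior_subset hr)).2.differentiableAt.differentiableWithinAt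
    · rw [(hα r (interior_subset hr)).2.deriv]
      exact (hβ0 r (interior_subset hr)).le
  have hβmono : MonotoneOn β (Ico r₀ T) := fun a ha b hb hab =>
    hκmono.monotoneOn (hα0 a ha) (hα0 b hb) (hαmono ha hb hab)
  have hsub : Ioo r₀ T ⊆ Ico r₀ T := Ioo_subset_Ico_self
  refine ⟨T, α, β, hT.1, fun r hr => ⟨(hα r hr).2, hβ0 r hr, (hα r hr).1⟩, ?_, ?_, hαε, hT.2,
    hlim⟩
  · have hcβ : ContinuousOn β (Ioo r₀ T) := fun r hr =>
      (hβd r (hsub hr)).continuousAt.continuousWithinAt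
    have hcα : ContinuousOn α (Ioo r₀ T) := fun r hr =>
      (hα r (hsub hr)).2.continuousAt.continuousWithinAt
    have hder : ContinuousOn (deriv β) (Ioo r₀ T) := by
      refine ContinuousOn.congr (f := fun r => σ * f (α r) * l (β r) / deriv φ (β r)) ?_
        fun r hr => (hβd r (hsub hr)).deriv
      refine ((continuousOn_const.mul (hf.continuousOn.comp hcα fun r hr =>
        (hα0 r (hsub hr)).le)).mul (hl.continuousOn.comp hcβ fun r hr =>
        (hβ0 r (hsub hr)).le)).div (hφ.continuousOn_deriv.comp hcβ fun r hr => hβ0 r (hsub hr)) ?_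
      exact fun r hr => (hφ.deriv_pos _ (hβ0 r (hsub hr))).ne'
    have := (contDiffOn_succ_iff_deriv_of_isOpen (n := 0) (f := β) isOpen_Ioo).2
      ⟨fun r hr => (hβd r (hsub hr)).differentiableAt.differentiableWithinAt, by simp,
        contDiffOn_zero.2 hder⟩
    simpa using this
  · intro r hr
    have hrI := hsub hr
    have p1 := hβ0 r hrI
    have p2 := hφ.deriv_pos _ p1
    have p3 := hl.pos _ p1
    have p4 := hf.pos _ (hα0 r hrI)
    have hr0 : 0 < r := hr₀.trans hr.1
    rw [(hβd r hrI).deriv]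
    refine ⟨by positivity, ?_⟩
    have hI0 : r₀ ∈ Ico r₀ T := ⟨le_rfl, hr.1.trans hr.2⟩
    have hIcc : Icc r₀ r ⊆ Ico r₀ T := fun x hx => ⟨hx.1, hx.2.trans_lt hr.2⟩
    -- Integrates `(φ(β))' = σ f(α) l(β)`, with `f(α)` bounded by its value at the right end and
    -- `l(β)` by `C` times its value there. Later `(r - r₀) / r ≤ 1` makes the friction bound
    -- uniform in `r`.
    have hmv : φ (β r) - φ (β r₀) ≤ σ * f (α r) * (C * l (β r)) * (r - r₀) := by
      refine Convex.image_sub_le_mul_sub_of_deriv_le (f := fun r => φ (β r)) (convex_Icc r₀ r)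
        (fun x hx => (hφβ x (hIcc hx)).continuousAt.continuousWithinAt)
        (fun x hx => (hφβ x (hIcc (interior_subset hx))).differentiableAt.differentiableWithinAt)
        (fun x hx => ?_) r₀ (left_mem_Icc.2 hr.1.le) r (right_mem_Icc.2 hr.1.le) hr.1.le
      have hx' := interior_subset hx
      have hxI := hIcc hx'
      rw [(hφβ x hxI).deriv]
      have q1 : f (α x) ≤ f (α r) := hf.monotoneOn (hα0 x hxI).le (hα0 r hrI).le
        (hαmono hxI hrI hx'.2)
      have q2 : l (β x) ≤ C * l (β r) :=
        hC _ p1.le _ ⟨(hβ0 x hxI).le, hβmono hxI hrI hx'.2⟩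
      exact mul_le_mul (mul_le_mul_of_nonneg_left q1 hσ0.le) q2 (hl.pos _ (hβ0 x hxI)).le
        (by positivity)
    -- The initial slope `κ ε` is positive, but lies below `t₀`, where `φ ≤ δ l`; this is the use of
    -- `φ / l → 0` at zero.
    have h0 : φ (β r₀) ≤ δ * (C * l (β r)) := by
      have e1 : β r₀ < t₀ := by
        refine lt_of_lt_of_le ?_ (min_le_left t₀ ((η - ε) / (r₁ - r₀)))
        refine lt_trans ?_ hκη
        change κ (α r₀) < κ η
        rw [hαε]
        exact hκmono hε hη0 hη
      refine (hsmall _ ⟨hβ0 _ hI0, e1⟩).trans (mul_le_mul_of_nonneg_left ?_ hδ0.le)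
      exact hC _ p1.le _ ⟨(hβ0 _ hI0).le, hβmono hI0 hrI hr.1.le⟩
    have hfle : f ε ≤ f (α r) := hf.monotoneOn hε.le (hα0 r hrI).le (hα r hrI).1
    set A := f (α r) * l (β r) with hA
    have hA0 : 0 < A := mul_pos p4 p3
    have t1 : deriv φ (β r) * (σ * f (α r) * l (β r) / deriv φ (β r)) = σ * A := by
      rw [hA]; field_simp
    have t2 : c / r * (σ * f (α r) * (C * l (β r)) * (r - r₀)) ≤ c * C * σ * A := by
      have e1 : c / r * (σ * f (α r) * (C * l (β r)) * (r - r₀)) =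
          c * C * σ * A * ((r - r₀) / r) := by rw [hA]; ring
      rw [e1]
      refine mul_le_of_le_one_right (by positivity) ?_
      rw [div_le_one hr0]
      linarith
    have t3 : c / r * (δ * (C * l (β r))) ≤ s / 2 * A := by
      have e1 : c / r * (δ * (C * l (β r))) =
          s / 2 * (c * C / (c * C + 1)) * (r₀ / r) * (f ε * l (β r)) := by
        rw [hδ]; field_simp
      have e2 : c * C / (c * C + 1) ≤ 1 := by
        rw [div_le_one (by positivity)]; linarith
      have e3 : r₀ / r ≤ 1 := by rw [div_le_one hr0]; exact hr.1.le
      have e4 : f ε * l (β r) ≤ A := mul_le_mul_of_nonneg_right hfle p3.le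
      have e5 : s / 2 * (c * C / (c * C + 1)) * (r₀ / r) ≤ s / 2 := by
        have : c * C / (c * C + 1) * (r₀ / r) ≤ 1 := mul_le_one₀ e2 (by positivity) e3
        nlinarith
      rw [e1]
      exact mul_le_mul e5 e4 (by positivity) (by positivity)
    have t4 := mul_le_mul_of_nonneg_left
      (by linarith : φ (β r) ≤ δ * (C * l (β r)) + σ * f (α r) * (C * l (β r)) * (r - r₀))
      (by positivity : 0 ≤ c / r)
    have t5 := mul_le_mul_of_nonneg_right hσ3 hA0.le
    have t6 : s * f (α r) * l (β r) = s * A := by rw [hA]; ring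
    rw [t1, t6]
    linarith

/-! ### Contact points off the axis -/

/-- `p` is a maximum point of `u - α(r)` over the gauge annulus `r₀ ≤ r ≤ T`. -/
def IsContactPoint (u : Heis m → ℝ) (α : ℝ → ℝ) (r₀ T : ℝ) (p : Heis m) : Prop :=
  IsMaxOn (fun p => u p - α (gauge p)) {p | gauge p ∈ Icc r₀ T} p ∧ gauge p ∈ Icc r₀ T

/-- The point with `x = a e_j`, `y = b e_j`, `t = s`. -/
def planePoint (j : Fin m) (a b s : ℝ) : Heis m := (Pi.single j a, Pi.single j b, s)

theorem gaugePow_planePoint (j : Fin m) (a b s : ℝ) :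
    gaugePow (planePoint j a b s) = (a ^ 2 + b ^ 2) ^ 2 + s ^ 2 := by
  have : zsq (planePoint j a b s) = a ^ 2 + b ^ 2 := by
    simp only [zsq, planePoint]
    rw [Finset.sum_eq_single j (fun i _ hi => by simp [hi]) (by simp)]
    simp
  rw [gaugePow, this]
  rfl

theorem leftMul_neg_planePoint (j : Fin m) (a b s a' b' s' : ℝ) :
    leftMul (-planePoint j a b s) (planePoint j a' b' s') =
      planePoint j (a' - a) (b' - b) (s' - s + 2 * (a * b' - b * a')) := by
  refine Prod.ext ?_ (Prod.ext ?_ ?_)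
  · simp only [leftMul, planePoint, Prod.fst_neg]
    rw [Pi.single_sub]
    abel
  · simp only [leftMul, planePoint, Prod.fst_neg, Prod.snd_neg]
    rw [Pi.single_sub]
    abel
  · simp only [leftMul, planePoint, Prod.fst_neg, Prod.snd_neg, Pi.neg_apply]
    rw [Finset.sum_eq_single j (fun i _ hi => by simp [hi]) (by simp)]
    simp
    ring

theorem leftMul_planePoint_axis (j : Fin m) (a b s h : ℝ) :
    leftMul (planePoint j a b s) (planePoint j 0 0 h) = planePoint j a b (s + h) := by
  have := leftMul_neg_planePoint j (-a) (-b) (-s) 0 0 h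
  have e : -planePoint j (-a) (-b) (-s) = planePoint j a b s := by
    simp [planePoint, ← Pi.single_neg]
  rw [e] at this
  rw [this]
  congr 1 <;> ring

theorem eq_planePoint_of_zsq_eq_zero (j : Fin m) {p : Heis m} (hp : zsq p = 0) :
    p = planePoint j 0 0 p.2.2 := by
  have h := (Finset.sum_eq_zero_iff_of_nonneg (fun i _ => by positivity)).1 hp
  have h1 : ∀ i, p.1 i = 0 ∧ p.2.1 i = 0 := fun i => by
    have := h i (Finset.mem_univ i)
    constructor <;> nlinarith [sq_nonneg (p.1 i), sq_nonneg (p.2.1 i)]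
  refine Prod.ext ?_ (Prod.ext ?_ rfl)
  · ext i; simp [planePoint, (h1 i).1]
  · ext i; simp [planePoint, (h1 i).2]

theorem gauge_lt_gauge_iff {p q : Heis m} : gauge p < gauge q ↔ gaugePow p < gaugePow q := by
  rw [← gauge_pow_four, ← gauge_pow_four,
    pow_lt_pow_iff_left₀ (gauge_nonneg p) (gauge_nonneg q) (by norm_num)]

theorem le_gauge_iff {p : Heis m} {r : ℝ} (hr : 0 ≤ r) : r ≤ gauge p ↔ r ^ 4 ≤ gaugePow p := by
  rw [← gauge_pow_four, pow_le_pow_iff_left₀ hr (gauge_nonneg p) (by norm_num)]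

section Contact

variable {u : Heis m → ℝ} {α : ℝ → ℝ} {r₀ T : ℝ}

/-- If the contact point on the axis for the centre `q'` is closer to the centre `q` than to
`q'`, then the maximal gap for the centre `q` is larger. -/
theorem contact_value_lt (j : Fin m) (hr₀ : 0 < r₀) (hα : StrictMonoOn α (Icc r₀ T))
    {a b s a' b' s' h h' : ℝ}
    (hq : IsContactPoint (fun p => u (leftMul (planePoint j a b s) p)) α r₀ T (planePoint j 0 0 h))
    (hq' : IsContactPoint (fun p => u (leftMul (planePoint j a' b' s') p)) α r₀ T
      (planePoint j 0 0 h'))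
    (hlow : r₀ ^ 4 ≤ (s' - s + 2 * (a * b' - b * a') + h') ^ 2)
    (hup : ((a' - a) ^ 2 + (b' - b) ^ 2) ^ 2 + (s' - s + 2 * (a * b' - b * a') + h') ^ 2 <
      h' ^ 2) :
    u (planePoint j a' b' (s' + h')) - α (gauge (planePoint j 0 0 h')) <
      u (planePoint j a b (s + h)) - α (gauge (planePoint j 0 0 h)) := by
  -- The contact point of the second centre as seen from the first. It competes in the first maximum
  -- with the same value of `u` but a strictly smaller `α`.
  set p := planePoint j (a' - a) (b' - b) (s' - s + 2 * (a * b' - b * a') + h') with hp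
  have hpe : leftMul (planePoint j a b s) p = planePoint j a' b' (s' + h') := by
    rw [← leftMul_leftMul_neg (planePoint j a b s) (planePoint j a' b' (s' + h')),
      leftMul_neg_planePoint, hp]
    congr 2
    ring
  have hlt : gauge p < gauge (planePoint j 0 0 h') := by
    rw [gauge_lt_gauge_iff, hp, gaugePow_planePoint, gaugePow_planePoint]
    linarith
  have hge : r₀ ≤ gauge p := by
    rw [le_gauge_iff hr₀.le, hp, gaugePow_planePoint]
    linarith [sq_nonneg ((a' - a) ^ 2 + (b' - b) ^ 2)]
  have hpI : gauge p ∈ Icc r₀ T := ⟨hge, hlt.le.trans hq'.2.2⟩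
  have h1 := hq.1 hpI
  simp only [mem_ofPred_eq, leftMul_planePoint_axis, hpe] at h1
  linarith [hα hpI hq'.2 hlt]

/-- On the axis the gauge is `√|h|`. The bound leaves room for height shifts up to `2 r₀²` without
leaving the annulus through its inner boundary. -/
theorem contact_height (j : Fin m) (hr₀ : 0 < r₀) {h : ℝ}
    (h2 : 2 * r₀ < gauge (planePoint j 0 0 h)) : 4 * r₀ ^ 2 < |h| := by
  have h3 : (2 * r₀) ^ 4 < gaugePow (planePoint j 0 0 h) := by
    rw [← gauge_pow_four]
    gcongr
  rw [gaugePow_planePoint, ← sq_abs h] at h3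
  refine lt_of_pow_lt_pow_left₀ 2 (abs_nonneg h) ?_
  linarith

theorem eventually_planePoint_mem (j : Fin m) (a b e : ℝ) {O : Set (Heis m)} (hO : O ∈ 𝓝 0) :
    ∀ᶠ ρ in 𝓝[>] (0 : ℝ), planePoint j (a * ρ) (b * ρ) (e * ρ ^ 2) ∈ O := by
  have hc : Continuous fun ρ : ℝ => planePoint j (a * ρ) (b * ρ) (e * ρ ^ 2) := by
    unfold planePoint
    refine Continuous.prodMk ?_ (Continuous.prodMk ?_ (by fun_prop))
    · exact (continuous_single j).comp (by fun_prop)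
    · exact (continuous_single j).comp (by fun_prop)
  have h0 := hc.tendsto 0
  have e0 : planePoint j (a * 0) (b * 0) (e * 0 ^ 2) = 0 := by simp [planePoint]
  rw [e0] at h0
  exact (h0.eventually hO).filter_mono nhdsWithin_le_nhds

/-- For some centre close to the origin, no contact point lies on the axis of the centre. This is
where the non-commutativity of the group is used: moving the centre around a small square of
side `ρ` shifts the height by an amount of order `ρ²`, to one side. -/
theorem exists_center_contact_off_axis (hm : 1 ≤ m) (hr₀ : 0 < r₀)
    (hα : StrictMonoOn α (Icc r₀ T)) {O : Set (Heis m)} (hO : O ∈ 𝓝 0)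
    (hin : ∀ q ∈ O, ∀ p, IsContactPoint (fun p => u (leftMul q p)) α r₀ T p → 2 * r₀ < gauge p) :
    ∃ q ∈ O, ∀ p, IsContactPoint (fun p => u (leftMul q p)) α r₀ T p → 0 < zsq p := by
  by_contra! hcon
  let j : Fin m := ⟨0, hm⟩
  have hax : ∀ q ∈ O, ∃ h, IsContactPoint (fun p => u (leftMul q p)) α r₀ T (planePoint j 0 0 h) ∧
      4 * r₀ ^ 2 < |h| := by
    intro q hq
    obtain ⟨p, hp, hz⟩ := hcon q hq
    have hpe := eq_planePoint_of_zsq_eq_zero j (le_antisymm hz (zsq_nonneg p))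
    rw [hpe] at hp
    exact ⟨p.2.2, hp, contact_height j hr₀ (hin q hq _ hp)⟩
  have h0 : planePoint j 0 0 0 = 0 := by simp [planePoint]
  obtain ⟨h₀, hc₀, hh₀⟩ := hax (planePoint j 0 0 0) (h0 ▸ mem_of_mem_nhds hO)
  -- `e` is the sign of the contact height for the origin; the loop is oriented accordingly.
  obtain ⟨e, he, heh⟩ : ∃ e : ℝ, e * e = 1 ∧ e * h₀ = |h₀| := by
    rcases le_total 0 h₀ with h | h
    · exact ⟨1, by norm_num, by rw [abs_of_nonneg h, one_mul]⟩
    · exact ⟨-1, by norm_num, by rw [abs_of_nonpos h, neg_one_mul]⟩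
  -- The four centres sit at the common height `e ρ²` over the corners of a square, ordered so that
  -- each step contributes `-2 e ρ²` to the relative height.
  obtain ⟨ρ, hq₁, hq₂, hq₃, hq₄, hρr, hρ⟩ := ((eventually_planePoint_mem j 1 0 e hO).and
    ((eventually_planePoint_mem j 0 (-e) e hO).and ((eventually_planePoint_mem j (-1) 0 e hO).and
    ((eventually_planePoint_mem j 0 e e hO).and
    (((eventually_le_nhds hr₀).filter_mono nhdsWithin_le_nhds).and
      self_mem_nhdsWithin))))).exists
  have hρ : 0 < ρ := hρ
  have hρ2r : ρ ^ 2 ≤ r₀ ^ 2 := by gcongr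
  have hρ2 : 0 < ρ ^ 2 := by positivity
  have hr4 : r₀ ^ 4 = (r₀ ^ 2) ^ 2 := by ring
  have hr2 : 0 < r₀ ^ 2 := by positivity
  -- All contact heights must have sign `e`. If one had the opposite sign, then, because its centre
  -- is raised by `e ρ²`, that centre and the origin would each be closer to the other's contact
  -- point, and each maximal gap would strictly exceed the other.
  have hsign : ∀ a b h : ℝ, (a ^ 2 + b ^ 2) = ρ ^ 2 → 4 * r₀ ^ 2 < |h| →
      IsContactPoint (fun p => u (leftMul (planePoint j a b (e * ρ ^ 2)) p)) α r₀ T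
        (planePoint j 0 0 h) → e * h = |h| := by
    intro a b h hab hh hc
    by_contra hne
    have hneg : e * h = -|h| := by
      have : |e| = 1 := by
        have := abs_mul_abs_self e
        rw [he] at this
        nlinarith [abs_nonneg e]
      have h1 : |e * h| = |h| := by rw [abs_mul, this, one_mul]
      rcases abs_choice (e * h) with h2 | h2
      · exact absurd (h2.symm.trans h1) hne
      · linarith
    have hh0 : h₀ = e * |h₀| := by rw [← heh, ← mul_assoc, he, one_mul]
    have hh1 : h = -(e * |h|) := by linear_combination -h * he + e * hneg
    have s1 : (0 - e * ρ ^ 2 + 2 * (a * 0 - b * 0) + h₀) ^ 2 = (|h₀| - ρ ^ 2) ^ 2 := by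
      rw [hh0, abs_mul, abs_abs, show |e| = 1 by
        have := abs_mul_abs_self e
        rw [he] at this
        nlinarith [abs_nonneg e]]
      linear_combination (|h₀| - ρ ^ 2) ^ 2 * he
    have s2 : (e * ρ ^ 2 - 0 + 2 * (0 * b - 0 * a) + h) ^ 2 = (|h| - ρ ^ 2) ^ 2 := by
      have : e * ρ ^ 2 - 0 + 2 * (0 * b - 0 * a) + h = -(e * (|h| - ρ ^ 2)) := by
        linear_combination hh1
      rw [this]
      linear_combination (|h| - ρ ^ 2) ^ 2 * he
    have l1 := contact_value_lt j hr₀ hα hc hc₀ (by rw [s1]; nlinarith)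
      (by rw [s1, ← sq_abs h₀]; nlinarith)
    have l2 := contact_value_lt j hr₀ hα hc₀ hc (by rw [s2]; nlinarith)
      (by rw [s2, ← sq_abs h]; nlinarith)
    exact lt_asymm l1 l2
  -- The fourth power of the gauge drops from `h'²` to `4ρ⁴ + (|h'| - 2ρ²)²`, which is smaller
  -- because `|h'| > 2ρ²`.
  have hstep : ∀ a b a' b' h h' : ℝ, (a' - a) ^ 2 + (b' - b) ^ 2 = 2 * ρ ^ 2 →
      a * b' - b * a' = -(e * ρ ^ 2) → 4 * r₀ ^ 2 < |h'| → a' ^ 2 + b' ^ 2 = ρ ^ 2 →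
      IsContactPoint (fun p => u (leftMul (planePoint j a b (e * ρ ^ 2)) p)) α r₀ T
        (planePoint j 0 0 h) →
      IsContactPoint (fun p => u (leftMul (planePoint j a' b' (e * ρ ^ 2)) p)) α r₀ T
        (planePoint j 0 0 h') →
      u (planePoint j a' b' (e * ρ ^ 2 + h')) - α (gauge (planePoint j 0 0 h')) <
        u (planePoint j a b (e * ρ ^ 2 + h)) - α (gauge (planePoint j 0 0 h)) := by
    intro a b a' b' h h' hd hw hh' hab' hc hc'
    have hs := hsign a' b' h' hab' hh' hc'
    have hh1 : h' = e * |h'| := by linear_combination -h' * he + e * hs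
    have s1 : (e * ρ ^ 2 - e * ρ ^ 2 + 2 * (a * b' - b * a') + h') ^ 2 =
        (|h'| - 2 * ρ ^ 2) ^ 2 := by
      have : e * ρ ^ 2 - e * ρ ^ 2 + 2 * (a * b' - b * a') + h' = e * (|h'| - 2 * ρ ^ 2) := by
        linear_combination hh1 + 2 * hw
      rw [this]
      linear_combination (|h'| - 2 * ρ ^ 2) ^ 2 * he
    refine contact_value_lt j hr₀ hα hc hc' (by rw [s1]; nlinarith) ?_
    rw [s1, hd, ← sq_abs h']
    nlinarith
  obtain ⟨h₁, c₁, k₁⟩ := hax _ hq₁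
  obtain ⟨h₂, c₂, k₂⟩ := hax _ hq₂
  obtain ⟨h₃, c₃, k₃⟩ := hax _ hq₃
  obtain ⟨h₄, c₄, k₄⟩ := hax _ hq₄
  have he2 : e ^ 2 = 1 := by rw [pow_two, he]
  have l₁ := hstep _ _ _ _ _ _ (by linear_combination ρ ^ 2 * he2) (by ring) k₂
    (by linear_combination ρ ^ 2 * he2) c₁ c₂
  have l₂ := hstep _ _ _ _ _ _ (by linear_combination ρ ^ 2 * he2) (by ring) k₃ (by ring) c₂ c₃
  have l₃ := hstep _ _ _ _ _ _ (by linear_combination ρ ^ 2 * he2) (by ring) k₄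
    (by linear_combination ρ ^ 2 * he2) c₃ c₄
  have l₄ := hstep _ _ _ _ _ _ (by linear_combination ρ ^ 2 * he2) (by ring) k₁ (by ring) c₄ c₁
  exact lt_asymm (l₁.trans' l₂) (l₃.trans' l₄)

end Contact

/-! ### Comparison with a radial supersolution -/

/-- On the compact set `K \ O` the maximum of `g` is attained and is below `μ`, so a level strictly
between confines the superlevel set to `O`. -/
theorem exists_gap_of_isMaxOn {X : Type*} [TopologicalSpace X] {K O : Set X} {g : X → ℝ} {μ : ℝ}
    (hK : IsCompact K) (hO : IsOpen O) (hg : ContinuousOn g K) (hle : ∀ x ∈ K, g x ≤ μ)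
    (hmax : ∀ x ∈ K, g x = μ → x ∈ O) : ∃ ν < μ, ∀ x ∈ K, ν ≤ g x → x ∈ O := by
  rcases (K \ O).eq_empty_or_nonempty with he | hne
  · exact ⟨μ - 1, by linarith, fun x hx _ => sdiff_eq_empty.1 he hx⟩
  · obtain ⟨x₀, hx₀, hx₀m⟩ := (hK.diff hO).exists_isMaxOn hne (hg.mono sdiff_subset)
    have hlt : g x₀ < μ := (hle x₀ hx₀.1).lt_of_ne fun h => hx₀.2 (hmax x₀ hx₀.1 h)
    refine ⟨(g x₀ + μ) / 2, by linarith, fun x hx hν => ?_⟩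
    by_contra hxO
    have : g x ≤ g x₀ := hx₀m ⟨hx, hxO⟩
    linarith

theorem contDiff_one_of_tsupport {E : Type*} [NormedAddCommGroup E] [NormedSpace ℝ E] {g : E → ℝ}
    (hg : ∀ x ∈ tsupport g, ContDiffAt ℝ 1 g x) : ContDiff ℝ 1 g :=
  contDiff_iff_contDiffAt.2 fun x => (em (x ∈ tsupport g)).elim (hg x) fun hx =>
    contDiffAt_const.congr_of_eventuallyEq (f := fun _ => (0 : ℝ))
      (notMem_tsupport_iff_eventuallyEq.1 hx)

theorem hgrad_congr {u v : Heis m → ℝ} {p : Heis m} (h : fderiv ℝ u p = fderiv ℝ v p) :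
    hgrad u p = hgrad v p := by
  simp only [hgrad, h]

theorem hgrad_of_hasFDerivAt_smul_sub {u v w : Heis m → ℝ} {p : Heis m} {c : ℝ}
    (h : HasFDerivAt w (c • (fderiv ℝ u p - fderiv ℝ v p)) p) :
    hgrad w p = c • (hgrad u p - hgrad v p) := by
  ext i
  rcases i with j | j <;> simp [hgrad, h.fderiv]

/-- Weak comparison: let `v` be a `C^1` function on an open set `O` whose flux is
`B • gaugeGrad`, of divergence less than `f(u) l(|∇u|)` there. Then `{u - v > ν}` is not a
nonempty subset of `O` contained in a compact subset of `O`. -/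
theorem not_exists_compact_superlevel {φ f l : ℝ → ℝ} (hφ : CondPhi φ) (hf : CondF f)
    (hl : CondL l) {u v B : Heis m → ℝ} (hu0 : ∀ q, 0 ≤ u q) (hu : IsWeakSolution φ f l u)
    {O S : Set (Heis m)} (hO : IsOpen O) (hS : IsCompact S) (hSO : S ⊆ O) {ν : ℝ}
    (hv : ContDiffOn ℝ 1 v O) (hB : ContDiffOn ℝ 1 B O)
    (hflux : ∀ p ∈ O, flux φ (hgrad v p) = B p • gaugeGrad p)
    (hstrict : ∀ p ∈ O, fderiv ℝ B p (hlift p (gaugeGrad p)) + (2 * m + 4) * zsq p * B p <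
      f (u p) * l ‖hgrad u p‖)
    (hsuper : ∀ p ∈ O, ν < u p - v p → p ∈ S) {p₀ : Heis m} (hp₀ : p₀ ∈ O)
    (hlt : ν < u p₀ - v p₀) : False := by
  classical
  -- A smooth nondecreasing function vanishing on `(-∞, 0]`, applied to the excess of `u - v` over
  -- `ν`. The cut-off to `O` is harmless, because the superlevel set within `O` lies in the compact
  -- set `S`.
  set w : Heis m → ℝ := O.indicator fun p => expNegInvGlue (u p - v p - ν) with hw
  have hw0 : ∀ p, 0 ≤ w p := fun p => indicator_nonneg (fun p _ => expNegInvGlue.nonneg _) p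
  have hwpos : 0 < w p₀ := by
    rw [hw, indicator_of_mem hp₀]
    exact expNegInvGlue.pos_of_pos (by linarith)
  have hwS : tsupport w ⊆ S := by
    refine closure_minimal (fun p hp => ?_) hS.isClosed
    have hpO : p ∈ O := by
      by_contra h
      exact hp (indicator_of_notMem h _)
    refine hsuper p hpO (lt_of_not_ge fun h => hp ?_)
    rw [hw, indicator_of_mem hpO]
    exact expNegInvGlue.zero_of_nonpos (by linarith)
  have hwO : tsupport w ⊆ O := hwS.trans hSO
  have hwc : HasCompactSupport w := hS.of_isClosed_subset (isClosed_tsupport w) hwS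
  have hweq : ∀ p ∈ O, w =ᶠ[𝓝 p] fun p => expNegInvGlue (u p - v p - ν) := fun p hp =>
    mem_of_superset (hO.mem_nhds hp) fun q hq => indicator_of_mem hq _
  have hvat : ∀ p ∈ O, ContDiffAt ℝ 1 v p := fun p hp => hv.contDiffAt (hO.mem_nhds hp)
  have hBat : ∀ p ∈ O, ContDiffAt ℝ 1 B p := fun p hp => hB.contDiffAt (hO.mem_nhds hp)
  have hglue : ContDiff ℝ 1 expNegInvGlue := expNegInvGlue.contDiff (n := 1)
  have hw1 : ContDiff ℝ 1 w := by
    refine contDiff_one_of_tsupport fun p hp => ?_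
    refine ContDiffAt.congr_of_eventuallyEq ?_ (hweq p (hwO hp))
    exact hglue.contDiffAt.comp p
      ((hu.1.contDiffAt.sub (hvat p (hwO hp))).sub contDiffAt_const)
  have hwd : ∀ p ∈ O, HasFDerivAt w
      (deriv expNegInvGlue (u p - v p - ν) • (fderiv ℝ u p - fderiv ℝ v p)) p := by
    intro p hp
    refine HasFDerivAt.congr_of_eventuallyEq ?_ (hweq p hp)
    refine HasDerivAt.comp_hasFDerivAt p (hglue.differentiable one_ne_zero _).hasDerivAt ?_
    exact ((hu.1.differentiable one_ne_zero p).hasFDerivAt.sub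
      ((hvat p hp).differentiableAt one_ne_zero).hasFDerivAt).sub_const ν
  have hdw0 : ∀ p, p ∉ O → fderiv ℝ w p = 0 := fun p hp =>
    image_eq_zero_of_notMem_tsupport fun h => hp (hwO (tsupport_fderiv_subset ℝ h))
  have hwz : ∀ p, p ∉ O → w p = 0 := fun p hp => indicator_of_notMem hp _
  have hdwc : Continuous (fderiv ℝ w) := hw1.continuous_fderiv one_ne_zero
  have hE : Continuous fun p : Heis m => hlift p (gaugeGrad p) := continuous_gaugeField
  have hsupp_dw : ∀ Z : Heis m → Heis m, tsupport (fun p => fderiv ℝ w p (Z p)) ⊆ tsupport w := by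
    intro Z
    refine closure_minimal (fun p hp => ?_) (isClosed_tsupport w)
    refine tsupport_fderiv_subset ℝ (subset_tsupport _ fun h => hp ?_)
    simp [h]
  set rhs : Heis m → ℝ := fun p => f (u p) * l ‖hgrad u p‖ with hrhs
  have hrhsc : Continuous rhs :=
    (hf.continuousOn.comp_continuous hu.1.continuous hu0).mul
      (hl.continuousOn.comp_continuous (continuous_hgrad hu.1).norm fun q => norm_nonneg _)
  have hZ : Continuous fun q => hlift q (flux φ (hgrad u q)) :=
    continuous_hlift ((continuous_flux hφ.continuousOn hφ.map_zero).comp (continuous_hgrad hu.1))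
  set dv : Heis m → ℝ := fun p =>
    fderiv ℝ B p (hlift p (gaugeGrad p)) + (2 * m + 4) * zsq p * B p with hdv
  have hdvc : ContinuousOn dv O :=
    ((hB.continuousOn_fderiv_of_isOpen hO le_rfl).clm_apply hE.continuousOn).add
      ((continuousOn_const.mul (contDiff_zsq (n := 0)).continuous.continuousOn).mul hB.continuousOn)
  have hk : ∀ {g : Heis m → ℝ}, ContinuousOn g O → tsupport g ⊆ tsupport w →
      Continuous g ∧ Integrable g := by
    intro g hg hgw
    have h1 : Continuous g := hg.continuous_of_tsupport_subset hO (hgw.trans hwO)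
    exact ⟨h1, h1.integrable_of_hasCompactSupport
      (hwc.of_isClosed_subset (isClosed_tsupport g) hgw)⟩
  have Ia := hk (g := fun p => rhs p * w p) (hrhsc.mul hw1.continuous).continuousOn
    tsupport_mul_subset_right
  have Ib := hk (g := fun p => fderiv ℝ w p (hlift p (flux φ (hgrad u p))))
    (hdwc.clm_apply hZ).continuousOn (hsupp_dw _)
  have Ic := hk (g := fun p => B p * fderiv ℝ w p (hlift p (gaugeGrad p)))
    (hB.continuousOn.mul (hdwc.clm_apply hE).continuousOn)
    (tsupport_mul_subset_right.trans (hsupp_dw _))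
  have Id := hk (g := fun p => dv p * w p) (hdvc.mul hw1.continuous.continuousOn)
    tsupport_mul_subset_right
  -- Applying the divergence theorem for `gaugeGrad` to `B w` integrates the flux of `v` by parts
  -- against `w`.
  have hBw : ContDiff ℝ 1 fun p => B p * w p := contDiff_one_of_tsupport fun p hp =>
    (hBat p (hwO (tsupport_mul_subset_right hp))).mul hw1.contDiffAt
  have hBwc : HasCompactSupport fun p => B p * w p := hwc.mul_left
  have hdiv := integral_fderiv_gaugeField hBw hBwc
  have Ie : Integrable fun p : Heis m => (2 * (m : ℝ) + 4) * zsq p * (B p * w p) :=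
    integrable_mul_of_hasCompactSupport hBw.continuous hBwc
      (continuous_const.mul (contDiff_zsq (n := 0)).continuous)
  have hdBw : ∀ p, fderiv ℝ (fun p => B p * w p) p (hlift p (gaugeGrad p)) =
      B p * fderiv ℝ w p (hlift p (gaugeGrad p)) + dv p * w p -
        (2 * (m : ℝ) + 4) * zsq p * (B p * w p) := by
    intro p
    by_cases hp : p ∈ O
    · have h1 := (((hBat p hp).differentiableAt one_ne_zero).hasFDerivAt.mul
        (hw1.differentiable one_ne_zero p).hasFDerivAt).fderiv
      change fderiv ℝ (B * w) p _ = _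
      rw [h1]
      simp [hdv]
      ring
    · have : fderiv ℝ (fun p => B p * w p) p = 0 :=
        image_eq_zero_of_notMem_tsupport fun h =>
          hp (hwO (tsupport_mul_subset_right (tsupport_fderiv_subset ℝ h)))
      simp [this, hwz p hp, hdw0 p hp]
  simp only [hdBw] at hdiv
  have Icd : Integrable fun p =>
      B p * fderiv ℝ w p (hlift p (gaugeGrad p)) + dv p * w p := Ic.2.add Id.2
  rw [integral_sub Icd Ie, integral_add Ic.2 Id.2] at hdiv
  have hweak := hu.integral_le hφ hf.continuousOn hl.continuousOn hu0 hw1 hwc hw0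
  -- On `O`, `∇w` is a nonnegative multiple of `∇u - ∇v`, so monotonicity of the flux compares the
  -- two integrals.
  have hmono : ∫ p, B p * fderiv ℝ w p (hlift p (gaugeGrad p)) ≤
      ∫ p, fderiv ℝ w p (hlift p (flux φ (hgrad u p))) := by
    refine integral_mono Ic.2 Ib.2 fun p => ?_
    by_cases hp : p ∈ O
    · have e1 : B p * fderiv ℝ w p (hlift p (gaugeGrad p)) =
          inner ℝ (flux φ (hgrad v p)) (hgrad w p) := by
        rw [hflux p hp, real_inner_smul_left, inner_hgrad]
      change B p * _ ≤ _
      rw [e1]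
      rw [← inner_hgrad, hgrad_of_hasFDerivAt_smul_sub (hwd p hp), real_inner_smul_right,
        real_inner_smul_right]
      refine mul_le_mul_of_nonneg_left ?_ expNegInvGlue.monotone.deriv_nonneg
      have := inner_flux_sub_flux_nonneg hφ.monotoneOn hφ.map_zero (hgrad u p) (hgrad v p)
      rw [inner_sub_left] at this
      linarith
    · simp [hdw0 p hp]
  have hpos : 0 < ∫ p, (rhs p * w p - dv p * w p) := by
    refine integral_pos_of_integrable_nonneg_nonzero (x := p₀) (Ia.1.sub Id.1) (Ia.2.sub Id.2)
      (fun p => ?_) ?_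
    · by_cases hp : p ∈ O
      · have : 0 ≤ (rhs p - dv p) * w p :=
          mul_nonneg (sub_nonneg.2 (hstrict p hp).le) (hw0 p)
        change 0 ≤ rhs p * w p - dv p * w p
        linarith
      · simp [hwz p hp]
    · rw [← sub_mul]
      exact (mul_pos (sub_pos.2 (hstrict p₀ hp₀)) hwpos).ne'
  rw [integral_sub Ia.2 Id.2] at hpos
  linarith

/-- A subsolution cannot touch a radial blow-up barrier from below (up to a positive constant)
at interior points off the axis only. -/
theorem not_contact_off_axis {φ f l α β : ℝ → ℝ} {u : Heis m → ℝ} {D Λ τ ε r₀ T T' : ℝ}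
    (hφ : CondPhi φ) (hf : CondF f) (hl : CondL l) (hD : 0 < D) (hΛ : 0 < Λ)
    (hφ2 : CondPhi2 φ D τ) (hl2 : CondL2 l Λ τ) (hu0 : ∀ q, 0 ≤ u q) (hu : IsWeakSolution φ f l u)
    (hε : 0 < ε) (hr₀ : 0 < r₀) (hT' : T' < T)
    (hα : ∀ r ∈ Ico r₀ T, HasDerivAt α (β r) r ∧ 0 < β r ∧ ε ≤ α r)
    (hβ : ContDiffOn ℝ 1 β (Ioo r₀ T))
    (hode : ∀ r ∈ Ioo r₀ T, 0 ≤ deriv β r ∧ deriv φ (β r) * deriv β r +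
      (2 * m + 1) / r * φ (β r) ≤ 1 / (2 * D * Λ) * f (α r) * l (β r))
    {p₀ : Heis m} (hp₀ : IsContactPoint u α r₀ T' p₀) (hpos : 0 < u p₀ - α (gauge p₀))
    (hint : ∀ p, IsContactPoint u α r₀ T' p → gauge p ∈ Ioo r₀ T' ∧ 0 < zsq p) : False := by
  set v : Heis m → ℝ := fun p => α (gauge p) with hv
  have huc : Continuous u := hu.1.continuous
  have hz : Continuous (zsq : Heis m → ℝ) := (contDiff_zsq (n := 0)).continuous
  have hK : IsCompact {p : Heis m | gauge p ∈ Icc r₀ T'} :=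
    (isCompact_gauge_le T').of_isClosed_subset (isClosed_Icc.preimage continuous_gauge)
      fun p hp => hp.2
  have hIcc : Icc r₀ T' ⊆ Ico r₀ T := fun r hr => ⟨hr.1, hr.2.trans_lt hT'⟩
  have hαc : ContinuousOn α (Icc r₀ T') := fun r hr =>
    (hα r (hIcc hr)).1.continuousAt.continuousWithinAt
  have huvc : ContinuousOn (fun p => u p - v p) {p : Heis m | gauge p ∈ Icc r₀ T'} :=
    huc.continuousOn.sub (hαc.comp continuous_gauge.continuousOn fun p hp => hp)
  set G : Set (Heis m) := {p | gauge p ∈ Ioo r₀ T' ∧ 0 < zsq p} with hG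
  have hGo : IsOpen G :=
    (isOpen_Ioo.preimage continuous_gauge).inter (isOpen_lt continuous_const hz)
  have hGI : ∀ p ∈ G, gauge p ∈ Ioo r₀ T := fun p hp => ⟨hp.1.1, hp.1.2.trans hT'⟩
  have hGI' : ∀ p ∈ G, gauge p ∈ Ico r₀ T := fun p hp => Ioo_subset_Ico_self (hGI p hp)
  have hr : ∀ p ∈ G, 0 < gauge p := fun p hp => hr₀.trans hp.1.1
  have hβat : ∀ p ∈ G, ContDiffAt ℝ 1 β (gauge p) := fun p hp =>
    hβ.contDiffAt (isOpen_Ioo.mem_nhds (hGI p hp))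
  have hB : ContDiffOn ℝ 1 (radialCoeff φ β) G := fun p hp =>
    (contDiffAt_radialCoeff hφ hp.2 (hβat p hp) (hα _ (hGI' p hp)).2.1).contDiffWithinAt
  have hαC : ContDiffOn ℝ 1 α (Ioo r₀ T) := by
    have := (contDiffOn_succ_iff_deriv_of_isOpen (n := 0) (f := α) (𝕜 := ℝ) isOpen_Ioo).2
      ⟨fun r hr => (hα r (Ioo_subset_Ico_self hr)).1.differentiableAt.differentiableWithinAt,
        by simp, contDiffOn_zero.2 (hβ.continuousOn.congr fun r hr =>
          (hα r (Ioo_subset_Ico_self hr)).1.deriv)⟩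
    simpa using this
  have hvC : ContDiffOn ℝ 1 v G := fun p hp =>
    ((hαC.contDiffAt (isOpen_Ioo.mem_nhds (hGI p hp))).comp p
      (contDiffAt_gauge (hr p hp))).contDiffWithinAt
  have hdivc : ContinuousOn (radialDiv φ β) G :=
    ((hB.continuousOn_fderiv_of_isOpen hGo le_rfl).clm_apply
      continuous_gaugeField.continuousOn).add
      ((continuous_const.mul hz).continuousOn.mul hB.continuousOn)
  have hrhs : Continuous fun p => f (u p) * l ‖hgrad u p‖ :=
    (hf.continuousOn.comp_continuous huc hu0).mul
      (hl.continuousOn.comp_continuous (continuous_hgrad hu.1).norm fun q => norm_nonneg _)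
  -- The region where the barrier satisfies the strict inequality required for comparison; it is
  -- open by continuity and will contain every contact point.
  set O : Set (Heis m) := G ∩ (fun p => radialDiv φ β p - f (u p) * l ‖hgrad u p‖) ⁻¹' Iio 0
    with hO
  have hOo : IsOpen O := (hdivc.sub hrhs.continuousOn).isOpen_inter_preimage hGo isOpen_Iio
  have hGsub : ∀ p ∈ G, gauge p ∈ Icc r₀ T' := fun p hp => Ioo_subset_Icc_self hp.1
  have hcontact : ∀ p, gauge p ∈ Icc r₀ T' → u p - v p = u p₀ - v p₀ → p ∈ O := by
    intro p hpK hpeq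
    have hpc : IsContactPoint u α r₀ T' p := by
      refine ⟨fun q hq => ?_, hpK⟩
      have := hp₀.1 hq
      change u q - α (gauge q) ≤ u p - v p
      rw [hpeq]
      exact this
    have hpG : p ∈ G := hint p hpc
    have hloc : IsLocalMax (fun q => u q - v q) p :=
      hpc.1.isLocalMax (mem_of_superset (hGo.mem_nhds hpG) hGsub)
    have hvd : DifferentiableAt ℝ v p :=
      (hvC.contDiffAt (hGo.mem_nhds hpG)).differentiableAt one_ne_zero
    have hud : DifferentiableAt ℝ u p := hu.1.differentiable one_ne_zero p
    have hfd := hloc.fderiv_eq_zero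
    rw [fderiv_fun_sub hud hvd, sub_eq_zero] at hfd
    obtain ⟨a1, a2, a3⟩ := hα _ (hGI' p hpG)
    have hgr : ‖hgrad u p‖ = √(zsq p) / gauge p * β (gauge p) := by
      rw [hgrad_congr hfd, norm_hgrad_radial (hr p hpG) a2.le a1]
    have hα0 : 0 < α (gauge p) := hε.trans_le a3
    have hle := radialDiv_le hφ hφ2 hl2 hD hΛ (hf.pos _ hα0).le hpG.2 (hβat p hpG) a2
      (hode _ (hGI p hpG)).1 (hode _ (hGI p hpG)).2
    have hup : α (gauge p) ≤ u p := by
      have h1 : 0 < u p - α (gauge p) := by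
        change 0 < u p - v p
        rw [hpeq]
        exact hpos
      linarith
    have hfu : f (α (gauge p)) ≤ f (u p) := hf.monotoneOn hα0.le (hu0 p) hup
    have hP : 0 < √(zsq p) / gauge p * β (gauge p) :=
      mul_pos (div_pos (Real.sqrt_pos.2 hpG.2) (hr p hpG)) a2
    have hlP := hl.pos _ hP
    refine ⟨hpG, ?_⟩
    rw [mem_preimage, mem_Iio, hgr]
    -- Equal gradients, `u ≥ α` and monotone `f` give the supersolution inequality with the factor
    -- `1/2`; positivity of `f l` off the axis makes it strict.
    have h1 := mul_le_mul_of_nonneg_right hfu hlP.le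
    have h2 := mul_pos (hf.pos _ hα0) hlP
    linarith
  obtain ⟨ν, hν, hνO⟩ := exists_gap_of_isMaxOn hK hOo huvc (fun p hp => hp₀.1 hp) hcontact
  have hSclosed : IsCompact ({p : Heis m | gauge p ∈ Icc r₀ T'} ∩ (fun p => u p - v p) ⁻¹' Ici ν) :=
    hK.of_isClosed_subset (huvc.preimage_isClosed_of_isClosed hK.isClosed isClosed_Ici)
      inter_subset_left
  refine not_exists_compact_superlevel hφ hf hl hu0 hu hOo hSclosed (fun p hp => hνO p hp.1 hp.2)
    (hvC.mono inter_subset_left) (hB.mono inter_subset_left) (fun p hp => ?_) (fun p hp => ?_)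
    (fun p hp h => ⟨hGsub p hp.1, h.le⟩) (hcontact p₀ hp₀.2 rfl) hν
  · obtain ⟨a1, a2, -⟩ := hα _ (hGI' p hp.1)
    exact flux_hgrad_radial (hr p hp.1) a2 hp.1.2 a1
  · have : radialDiv φ β p - f (u p) * l ‖hgrad u p‖ < 0 := hp.2
    rw [radialDiv] at this
    linarith

/-! ### Touching argument at the origin and conclusion -/

/-- An entire nonnegative subsolution does not take a value larger than its value at the origin. -/
theorem IsWeakSolution.le_apply_zero {φ f l : ℝ → ℝ} {u : Heis m → ℝ} {D Λ τ : ℝ} (hm : 1 ≤ m)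
    (hφ : CondPhi φ) (hf : CondF f) (hl : CondL l) (hφl : CondPhiL φ l) (hD : 0 < D) (hΛ : 0 < Λ)
    (hφ2 : CondPhi2 φ D τ) (hl2 : CondL2 l Λ τ) (hKO : KellerOsserman φ f l)
    (hu0 : ∀ q, 0 ≤ u q) (hu : IsWeakSolution φ f l u) (p₁ : Heis m) : u p₁ ≤ u 0 := by
  by_contra! hlt
  have huc : Continuous u := hu.1.continuous
  obtain ⟨ε, hε1, hε2⟩ := exists_between hlt
  obtain ⟨η, hη1, hη2⟩ := exists_between hε2
  have hε : 0 < ε := (hu0 0).trans_lt hε1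
  have hmul : Continuous fun q : Heis m × Heis m => u (leftMul q.1 q.2) :=
    huc.comp continuous_leftMul_uncurry
  have hg0 : gauge (0 : Heis m) = 0 := by simp [gauge, gaugePow, zsq]
  obtain ⟨U, hU, V, hV, hUV⟩ : ∃ U ∈ 𝓝 (0 : Heis m), ∃ V ∈ 𝓝 (0 : Heis m),
      ∀ q ∈ U, ∀ p ∈ V, u (leftMul q p) < ε := by
    have h1 : ∀ᶠ q in 𝓝 ((0 : Heis m), (0 : Heis m)), u (leftMul q.1 q.2) < ε := by
      refine (hmul.tendsto _).eventually (gt_mem_nhds ?_)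
      simpa [leftMul_zero_left] using hε1
    rw [nhds_prod_eq] at h1
    obtain ⟨U, hU, V, hV, h⟩ := mem_prod_iff.1 h1
    exact ⟨U, hU, V, hV, fun q hq p hp => h (mk_mem_prod hq hp)⟩
  -- Small gauge balls form a neighbourhood basis at the origin: otherwise the gauge would attain a
  -- positive minimum on a compact set avoiding the interior of `V`, and a ball of smaller radius
  -- would violate it.
  obtain ⟨r₀, hr₀, hr₀V⟩ : ∃ r₀ : ℝ, 0 < r₀ ∧ ∀ p : Heis m, gauge p ≤ 2 * r₀ → p ∈ V := by
    by_contra! hcon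
    have hW : IsCompact ({p : Heis m | gauge p ≤ 2} \ interior V) :=
      (isCompact_gauge_le 2).diff isOpen_interior
    obtain ⟨p, hp, hpV⟩ := hcon 1 one_pos
    obtain ⟨p', hp', hmin⟩ := hW.exists_isMinOn
      ⟨p, by simpa using hp, fun h => hpV (interior_subset h)⟩ continuous_gauge.continuousOn
    have hp'0 : 0 < gauge p' := by
      refine (gauge_nonneg p').lt_of_ne' fun h0 => hp'.2 ?_
      have hN : gaugePow p' = 0 := by rw [← gauge_pow_four, h0]; norm_num
      have hz0 : zsq p' = 0 := by
        unfold gaugePow at hN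
        nlinarith [sq_nonneg (zsq p'), sq_nonneg p'.2.2]
      have ht0 : p'.2.2 = 0 := by
        rw [gaugePow, hz0] at hN
        simpa using hN
      have : p' = 0 := by
        rw [eq_planePoint_of_zsq_eq_zero ⟨0, hm⟩ hz0, ht0]
        simp [planePoint]
      rw [this]
      exact mem_interior_iff_mem_nhds.2 hV
    obtain ⟨q, hq, hqV⟩ := hcon (gauge p' / 4) (by positivity)
    have h2 : gauge p' ≤ 2 := hp'.1
    have : gauge p' ≤ gauge q := hmin
      ⟨by change gauge q ≤ 2; linarith, fun h => hqV (interior_subset h)⟩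
    linarith
  set r₁ := max (gauge p₁) r₀ + 1 with hr₁
  have hr01 : r₀ < r₁ := by linarith [le_max_right (gauge p₁) r₀]
  have hp₁r : gauge p₁ < r₁ := by linarith [le_max_left (gauge p₁) r₀]
  obtain ⟨T, α, β, hT, hα, hβ, hode, hαr₀, hαr₁, hlim⟩ := exists_barrier hφ hf hl hφl hKO
    (c := 2 * m + 1) (s := 1 / (2 * D * Λ)) hε hη1 hr₀ hr01 (by positivity) (by positivity)
  have hcpt : IsCompact (Metric.closedBall (0 : Heis m) 1 ×ˢ {p : Heis m | gauge p ≤ T}) :=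
    (isCompact_closedBall _ _).prod (isCompact_gauge_le T)
  obtain ⟨M, hM⟩ := (hcpt.image hmul).bddAbove
  have hM' : ∀ q ∈ Metric.closedBall (0 : Heis m) 1, ∀ p, gauge p ≤ T → u (leftMul q p) ≤ M :=
    fun q hq p hp => hM ⟨(q, p), ⟨hq, hp⟩, rfl⟩
  -- Stop just before blow-up, once `α` exceeds the bound `M` for `u`, which is uniform in the
  -- centre; no positive gap is then possible on the outer sphere `r = T'`.
  obtain ⟨T', hMT', hT'1, hT'⟩ := ((hlim.eventually (eventually_ge_atTop M)).and
    (Ioo_mem_nhdsLT hT)).exists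
  have hIcc : Icc r₀ T' ⊆ Ico r₀ T := fun r hr => ⟨hr.1, hr.2.trans_lt hT'⟩
  have hαm : StrictMonoOn α (Icc r₀ T') := by
    refine strictMonoOn_of_deriv_pos (convex_Icc _ _)
      (fun r hr => (hα r (hIcc hr)).1.continuousAt.continuousWithinAt) fun r hr => ?_
    have hr' := hIcc (interior_subset hr)
    rw [(hα r hr').1.deriv]
    exact (hα r hr').2.1
  have hfar : ∀ q ∈ U, ∀ p, ε ≤ u (leftMul q p) → 2 * r₀ < gauge p := by
    intro q hq p hp
    by_contra! h
    exact absurd (hUV q hq p (hr₀V p h)) (not_lt.2 hp)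
  -- Admissible centres: `u < ε` near the centre, the uniform bound `M` holds, and `p₁` stays within
  -- `r₁`, where `α ≤ η < u p₁`.
  set O : Set (Heis m) := U ∩ (Metric.closedBall 0 1 ∩ {q | gauge (leftMul (-q) p₁) < r₁}) with hO
  have hOn : O ∈ 𝓝 0 := by
    refine inter_mem hU (inter_mem (Metric.closedBall_mem_nhds _ one_pos) ?_)
    have hc : Continuous fun q : Heis m => gauge (leftMul (-q) p₁) :=
      continuous_gauge.comp (continuous_leftMul_uncurry.comp
        (continuous_neg.prodMk continuous_const))
    refine (hc.tendsto 0).eventually (gt_mem_nhds ?_)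
    simpa [leftMul_zero_left] using hp₁r
  have hgap : ∀ q ∈ O, ∀ p, IsContactPoint (fun p => u (leftMul q p)) α r₀ T' p →
      0 < u (leftMul q p) - α (gauge p) := by
    intro q hq p hp
    have hback : leftMul q (leftMul (-q) p₁) = p₁ := leftMul_leftMul_neg q p₁
    have hlow : 2 * r₀ < gauge (leftMul (-q) p₁) := hfar q hq.1 _ (by rw [hback]; exact hε2.le)
    have hup : gauge (leftMul (-q) p₁) < r₁ := hq.2.2
    have hI : gauge (leftMul (-q) p₁) ∈ Icc r₀ T' := ⟨by linarith, by linarith⟩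
    have h1 := hp.1 hI
    simp only [mem_ofPred_eq, hback] at h1
    have h2 := hαm hI ⟨hr01.le, hT'1.le⟩ hup
    linarith
  have hnear : ∀ q ∈ O, ∀ p, IsContactPoint (fun p => u (leftMul q p)) α r₀ T' p →
      2 * r₀ < gauge p := fun q hq p hp => by
    have h1 := hgap q hq p hp
    have h2 := (hα _ (hIcc hp.2)).2.2
    exact hfar q hq.1 p (by linarith)
  obtain ⟨q, hq, hoff⟩ := exists_center_contact_off_axis hm hr₀ hαm hOn hnear
  have hK : IsCompact {p : Heis m | gauge p ∈ Icc r₀ T'} :=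
    (isCompact_gauge_le T').of_isClosed_subset (isClosed_Icc.preimage continuous_gauge)
      fun p hp => hp.2
  have hαc : ContinuousOn α (Icc r₀ T') := fun r hr =>
    (hα r (hIcc hr)).1.continuousAt.continuousWithinAt
  obtain ⟨p₀, hp₀, hmax⟩ := hK.exists_isMaxOn (f := fun p => u (leftMul q p) - α (gauge p))
    ⟨leftMul (-q) p₁, by
      have hback : leftMul q (leftMul (-q) p₁) = p₁ := leftMul_leftMul_neg q p₁
      have := hfar q hq.1 (leftMul (-q) p₁) (by rw [hback]; exact hε2.le)
      have hup : gauge (leftMul (-q) p₁) < r₁ := hq.2.2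
      exact ⟨by linarith, by linarith⟩⟩
    ((hmul.comp (by fun_prop : Continuous fun p : Heis m => (q, p))).continuousOn.sub
      (hαc.comp continuous_gauge.continuousOn fun p hp => hp))
  have hp₀c : IsContactPoint (fun p => u (leftMul q p)) α r₀ T' p₀ := ⟨hmax, hp₀⟩
  refine not_contact_off_axis hφ hf hl hD hΛ hφ2 hl2 (fun p => hu0 _) (hu.comp_leftMul q) hε hr₀ hT'
    hα hβ hode hp₀c (hgap q hq p₀ hp₀c) fun p hp => ⟨⟨?_, ?_⟩, hoff p hp⟩
  · linarith [hnear q hq p hp]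
  · refine hp.2.2.lt_of_ne fun h => ?_
    have h1 := hgap q hq p hp
    have h2 := hM' q hq.2.1 p (hp.2.2.trans hT'.le)
    rw [h] at h1
    linarith

/-- A constant weak solution vanishes if `l(0) > 0`. -/
theorem IsWeakSolution.eq_zero_of_const {φ f l : ℝ → ℝ} {c : ℝ} (hf : CondF f) (hl0 : 0 < l 0)
    (hc : 0 ≤ c) (hu : IsWeakSolution φ f l (fun _ : Heis m => c)) : c = 0 := by
  by_contra hne
  have hcpos : 0 < c := hc.lt_of_ne' hne
  let b : ContDiffBump (0 : Heis m) := ⟨1, 2, one_pos, one_lt_two⟩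
  have hg : ∀ q : Heis m, hgrad (fun _ : Heis m => c) q = 0 := by
    intro q
    ext i
    rcases i with j | j <;> simp [hgrad]
  -- The flux of a constant vanishes, so the inequality reads `f(c) l(0) ∫ b ≤ 0`.
  have h := hu.2 b b.contDiff b.hasCompactSupport fun q => b.nonneg
  simp only [hg, norm_zero, inner_zero_left, mul_zero, integral_zero, neg_zero] at h
  rw [integral_const_mul] at h
  have := mul_pos (mul_pos (hf.pos c hcpos) hl0) (b.integral_pos (μ := volume))
  linarith

end

end HeisenbergLiouville

theorem mainTheorem1 (m : ℕ) (hm : 1 ≤ m) (φ f l : ℝ → ℝ)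
    (hφ : HeisenbergLiouville.CondPhi φ)
    (hf : HeisenbergLiouville.CondF f)
    (hl : HeisenbergLiouville.CondL l)
    (hφl : HeisenbergLiouville.CondPhiL φ l)
    (D Λ τ : ℝ) (hD : 0 < D) (hΛ : 0 < Λ) (hτ : 0 ≤ τ)
    (hφ2 : HeisenbergLiouville.CondPhi2 φ D τ)
    (hl2 : HeisenbergLiouville.CondL2 l Λ τ)
    (hKO : HeisenbergLiouville.KellerOsserman φ f l)
    (u : HeisenbergLiouville.Heis m → ℝ) (hu0 : ∀ q, 0 ≤ u q)
    (hu : HeisenbergLiouville.IsWeakSolution φ f l u) :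
    (∃ c : ℝ, ∀ q, u q = c) ∧ (0 < l 0 → ∀ q, u q = 0) := by
  -- Translating `q` to the origin gives the comparison for every ordered pair of points, hence
  -- equality by symmetry.
  have hle : ∀ p q, u p ≤ u q := by
    intro p q
    have := (hu.comp_leftMul q).le_apply_zero hm hφ hf hl hφl hD hΛ hφ2 hl2 hKO (fun _ => hu0 _)
      (HeisenbergLiouville.leftMul (-q) p)
    rwa [HeisenbergLiouville.leftMul_leftMul_neg, HeisenbergLiouville.leftMul_zero_right] at this
  have hconst : ∀ q, u q = u 0 := fun q => le_antisymm (hle q 0) (hle 0 q)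
  refine ⟨⟨u 0, hconst⟩, fun hl0 q => ?_⟩
  have hueq : u = fun _ => u 0 := funext hconst
  rw [hueq] at hu
  rw [hconst q]
  exact hu.eq_zero_of_const hf hl0 (hu0 0)
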